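/- **Conventions.** All spaces are real. Let $(\Omega,\Sigma,\mu)$ be a $\sigma$-finite measure space. A Banach function lattice on it is a linear subspace $X\subset L^0(\mu)$ with a complete norm such that $f\in L^0(\mu)$, $g\in X$, $|f|\le|g|$ a.e. imply $f\in X$ and $\|f\|_X\le\|g\|_X$. For $1\le p<\infty$, $p$-convex means $p$-convex with constant one, that is, $$\Big\|\Big(\sum_{k=1}^n|x_k|^p\Big)^{1/p}\Big\|_X\le\Big(\sum_{k=1}^n\|x_k\|_X^p\Big)^{1/p}\qquad(x_1,\dots,x_n\in X).$$ In that case $X_p=\{f\in L^0(\mu): |f|^{1/p}\in X\}$ with $\|f\|_{X_p}=\big\||f|^{1/p}\big\|_X^p$ is the $p$-concavification of $X$, $B_{(X_p)^*}$ is the closed unit ball of its dual with the weak$^*$ topology, and $B^+_{(X_p)^*}$ is the set of positive functionals in it. For $p\le q<\infty$ and a regular Borel probability measure $\nu$ on $B_{(X_p)^*}$ put $$\|x\|_{p,q,\nu}=\Big(\int_{B^+_{(X_p)^*}}\langle|x|^p,x^*\rangle^{q/p}\,d\nu(x^*)\Big)^{1/q}\qquad(x\in X).$$ This is a seminorm on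 $X$ with $\|x\|_{p,q,\nu}\le\|x\|_X$. With $N=\{x\in X:\|x\|_{p,q,\nu}=0\}$, let $\widetilde F^{q}_{X_p}(\nu)$ be the completion of $X/N$ for the norm induced by $\|\cdot\|_{p,q,\nu}$, and let $\iota_X\colon X\to\widetilde F^{q}_{X_p}(\nu)$, $\iota_X(x)=[x]$, be the canonical bounded linear map. **Theorem.** Let $m\ge1$, let $1\le p_j\le q_j<\infty$, let $r_j\in(1,\infty]$ be given by $1/r_j=1/p_j-1/q_j$ for $1\le j\le m$, and let $1/q=1/q_1+\dots+1/q_m$. Let $X_j$ be a $p_j$-convex Banach function lattice on a $\sigma$-finite measure space for $1\le j\le m$, let $Y$ be a Banach space and let $T\colon X_1\times\dots\times X_m\to Y$ be a multilinear map. The following are equivalent. (i) $T$ is $(p_1,\dots,p_m)$-strongly $(q_1,\dots,q_m)$-concave: there is a constant $C>0$ such that for every $n$ and all finite sequences $(x_k^j)_{k=1}^n$ in $X_j$, $1\le j\le m$, $$\Big(\sum_{k=1}^n\|T(x_k^1,\dots,x_k^m)\|_Y^q\Big)^{1/q}\le C\prod_{j=1}^m\ \sup_{(\beta_k)\in B_{\ell_{r_j}^n}}\Big\|\Big(\sum_{k=1}^n|\beta_kx_k^j|^{p_j}\Big)^{1/p_j}\Big\|_{X_j}.$$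 (ii) There are regular Borel probability measures $\nu_j$ on $B_{((X_j)_{p_j})^*}$, $1\le j\le m$, and a bounded multilinear map $S\colon\widetilde F^{q_1}_{(X_1)_{p_1}}(\nu_1)\times\dots\times\widetilde F^{q_m}_{(X_m)_{p_m}}(\nu_m)\to Y$ such that $T=S\circ(\iota_{X_1}\times\dots\times\iota_{X_m})$. -/

import Mathlib

open MeasureTheory Filter Topology
open scoped ENNReal

noncomputable section

/-- The class of `ω ↦ |f ω| ^ p` in `L⁰(μ)`. -/
def absPow {Ω : Type*} [MeasurableSpace Ω] {μ : Measure Ω} (p : ℝ) (f : Ω →ₘ[μ] ℝ) : Ω →ₘ[μ] ℝ :=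
  AEEqFun.compMeasurable (fun t : ℝ => |t| ^ p) (by fun_prop) f

theorem coeFn_absPow {Ω : Type*} [MeasurableSpace Ω] {μ : Measure Ω} (p : ℝ) (f : Ω →ₘ[μ] ℝ) :
    absPow p f =ᵐ[μ] fun ω => |f ω| ^ p :=
  AEEqFun.coeFn_compMeasurable _ _ _

/-- A Banach function lattice over `μ`: a linear subspace `X` of `L⁰(μ)` (the space of `μ`-a.e.
classes of real measurable functions) with a complete norm such that `f ∈ L⁰(μ)`, `g ∈ X` and
`|f| ≤ |g|` a.e. imply `f ∈ X` and `‖f‖ ≤ ‖g‖`. -/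
structure BanachFunctionLattice {Ω : Type*} [MeasurableSpace Ω] (μ : Measure Ω) where
  toSubmodule : Submodule ℝ (Ω →ₘ[μ] ℝ)
  normFun : toSubmodule → ℝ
  normFun_nonneg : ∀ f, 0 ≤ normFun f
  normFun_smul : ∀ (c : ℝ) (f), normFun (c • f) = |c| * normFun f
  normFun_add_le : ∀ f g, normFun (f + g) ≤ normFun f + normFun g
  normFun_eq_zero : ∀ f, normFun f = 0 → f = 0
  solid : ∀ (f : Ω →ₘ[μ] ℝ) (g : toSubmodule), |f| ≤ |(g : Ω →ₘ[μ] ℝ)| →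
    ∃ hf : f ∈ toSubmodule, normFun ⟨f, hf⟩ ≤ normFun g
  complete : ∀ u : ℕ → toSubmodule,
    (∀ ε > 0, ∃ N, ∀ i ≥ N, ∀ j ≥ N, normFun (u i - u j) < ε) →
      ∃ f, Tendsto (fun i => normFun (u i - f)) atTop (𝓝 0)

namespace BanachFunctionLattice

variable {Ω : Type*} [MeasurableSpace Ω] {μ : Measure Ω}

/-- The elements of a Banach function lattice. -/
def Elem (X : BanachFunctionLattice μ) : Type _ := X.toSubmodule

instance (X : BanachFunctionLattice μ) : AddCommGroup X.Elem :=
  inferInstanceAs (AddCommGroup X.toSubmodule)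

instance (X : BanachFunctionLattice μ) : Module ℝ X.Elem :=
  inferInstanceAs (Module ℝ X.toSubmodule)

instance (X : BanachFunctionLattice μ) : Norm X.Elem := ⟨X.normFun⟩

theorem elemCore (X : BanachFunctionLattice μ) : NormedSpace.Core ℝ X.Elem where
  norm_nonneg := X.normFun_nonneg
  norm_smul := X.normFun_smul
  norm_triangle := X.normFun_add_le
  norm_eq_zero_iff f := ⟨X.normFun_eq_zero f, fun h => by
    have := X.normFun_smul 0 0
    rw [smul_zero, abs_zero, zero_mul] at this
    rw [h]
    exact this⟩

instance (X : BanachFunctionLattice μ) : NormedAddCommGroup X.Elem :=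
  NormedAddCommGroup.ofCore X.elemCore

instance (X : BanachFunctionLattice μ) : NormedSpace ℝ X.Elem :=
  NormedSpace.ofCore X.elemCore

/-- The inclusion of `X` into `L⁰(μ)`. -/
def toL0 (X : BanachFunctionLattice μ) : X.Elem →ₗ[ℝ] (Ω →ₘ[μ] ℝ) := X.toSubmodule.subtype

theorem toL0_mem {X : BanachFunctionLattice μ} (f : X.Elem) : X.toL0 f ∈ X.toSubmodule :=
  f.property

theorem mem_of_abs_le {X : BanachFunctionLattice μ} {f : Ω →ₘ[μ] ℝ} (g : X.Elem)
    (h : |f| ≤ |X.toL0 g|) : f ∈ X.toSubmodule :=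
  (X.solid f g h).1

theorem norm_le_of_abs_le {X : BanachFunctionLattice μ} {f g : X.Elem}
    (h : |X.toL0 f| ≤ |X.toL0 g|) : ‖f‖ ≤ ‖g‖ :=
  (X.solid (X.toL0 f) g h).2

theorem abs_le_abs_iff_ae {f g : Ω →ₘ[μ] ℝ} : |f| ≤ |g| ↔ ∀ᵐ ω ∂μ, |f ω| ≤ |g ω| := by
  rw [← AEEqFun.coeFn_le]
  constructor <;> intro h <;>
    filter_upwards [h, AEEqFun.coeFn_abs f, AEEqFun.coeFn_abs g] with ω h1 h2 h3
  · rwa [h2, h3] at h1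
  · rwa [h2, h3]

theorem abs_abs_le (f : Ω →ₘ[μ] ℝ) : |(|f|)| ≤ |f| := by
  rw [abs_le_abs_iff_ae]
  filter_upwards [AEEqFun.coeFn_abs f] with ω h
  rw [h, abs_abs]

/-! ### `p`-sums and convexity -/

/-- The class of `(∑ₖ |xₖ| ^ p) ^ (1/p)` in `L⁰(μ)`. -/
def lpSumL0 (p : ℝ) {n : ℕ} (x : Fin n → (Ω →ₘ[μ] ℝ)) : Ω →ₘ[μ] ℝ :=
  absPow (1 / p) (∑ k, absPow p (x k))

theorem coeFn_lpSumL0 (p : ℝ) {n : ℕ} (x : Fin n → (Ω →ₘ[μ] ℝ)) :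
    ∀ᵐ ω ∂μ, lpSumL0 p x ω = (∑ k, |x k ω| ^ p) ^ (1 / p) := by
  have h : ∀ᵐ ω ∂μ, ∀ k, absPow p (x k) ω = |x k ω| ^ p :=
    ae_all_iff.2 fun k => coeFn_absPow p (x k)
  filter_upwards [coeFn_absPow (1 / p) (∑ k, absPow p (x k)),
    AEEqFun.coeFn_finsetSum (Finset.univ) (fun k => absPow p (x k)), h] with ω h1 h2 h3
  rw [lpSumL0, h1, h2]
  simp only [Finset.sum_apply, h3]
  rw [abs_of_nonneg (Finset.sum_nonneg fun k _ => Real.rpow_nonneg (abs_nonneg _) _)]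

theorem rpow_sum_le_sum {n : ℕ} {p : ℝ} (hp : 1 ≤ p) (a : Fin n → ℝ) (ha : ∀ k, 0 ≤ a k) :
    (∑ k, a k ^ p) ^ (1 / p) ≤ ∑ k, a k := by
  have hp0 : 0 < p := by linarith
  have hs : 0 ≤ ∑ k, a k := Finset.sum_nonneg fun k _ => ha k
  rw [one_div, Real.rpow_inv_le_iff_of_pos
    (Finset.sum_nonneg fun k _ => Real.rpow_nonneg (ha k) _) hs hp0]
  have h1 : ∀ k, a k ^ p ≤ a k * (∑ k, a k) ^ (p - 1) := fun k => by
    rcases (ha k).eq_or_lt with h | h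
    · rw [← h, Real.zero_rpow hp0.ne']; simp
    · have : a k ^ p = a k * a k ^ (p - 1) := by
        rw [← Real.rpow_one_add' h.le (by linarith)]; congr 1; ring
      rw [this]
      refine mul_le_mul_of_nonneg_left (Real.rpow_le_rpow h.le ?_ (by linarith)) h.le
      exact Finset.single_le_sum (fun i _ => ha i) (Finset.mem_univ k)
  calc ∑ k, a k ^ p ≤ ∑ k, a k * (∑ k, a k) ^ (p - 1) := Finset.sum_le_sum fun k _ => h1 k
    _ = (∑ k, a k) * (∑ k, a k) ^ (p - 1) := by rw [Finset.sum_mul]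
    _ = (∑ k, a k) ^ p := by
      rw [← Real.rpow_one_add' hs (by linarith)]; congr 1; ring

theorem lpSumL0_mem (X : BanachFunctionLattice μ) {p : ℝ} (hp : 1 ≤ p) {n : ℕ}
    (x : Fin n → X.Elem) : lpSumL0 p (fun k => X.toL0 (x k)) ∈ X.toSubmodule := by
  have habs : ∀ k, |X.toL0 (x k)| ∈ X.toSubmodule := fun k =>
    mem_of_abs_le (x k) (abs_abs_le _)
  let g : X.Elem := (⟨∑ k, |X.toL0 (x k)|, Submodule.sum_mem _ fun k _ => habs k⟩ : X.toSubmodule)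
  refine mem_of_abs_le g (abs_le_abs_iff_ae.2 ?_)
  have h : ∀ᵐ ω ∂μ, ∀ k, |X.toL0 (x k)| ω = |X.toL0 (x k) ω| :=
    ae_all_iff.2 fun k => AEEqFun.coeFn_abs _
  filter_upwards [coeFn_lpSumL0 p (fun k => X.toL0 (x k)), h,
    AEEqFun.coeFn_finsetSum (Finset.univ) (fun k => |X.toL0 (x k)|)] with ω h1 h2 h3
  change _ ≤ |(∑ k, |X.toL0 (x k)|) ω|
  rw [h1, h3, abs_of_nonneg (by positivity)]
  refine le_trans ?_ (le_abs_self _)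
  simp only [Finset.sum_apply, h2]
  exact rpow_sum_le_sum hp _ fun k => abs_nonneg _

/-- The element `(∑ₖ |xₖ| ^ p) ^ (1/p)` of `X`, for `x₁, …, xₙ` in `X`. -/
def lpSum (X : BanachFunctionLattice μ) {p : ℝ} (hp : 1 ≤ p) {n : ℕ} (x : Fin n → X.Elem) :
    X.Elem :=
  (⟨lpSumL0 p (fun k => X.toL0 (x k)), X.lpSumL0_mem hp x⟩ : X.toSubmodule)

theorem toL0_lpSum (X : BanachFunctionLattice μ) {p : ℝ} (hp : 1 ≤ p) {n : ℕ}
    (x : Fin n → X.Elem) : X.toL0 (X.lpSum hp x) = lpSumL0 p (fun k => X.toL0 (x k)) := rfl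

/-- `X` is `p`-convex, `1 ≤ p < ∞`, with `p`-convexity constant one. -/
structure IsPConvex (X : BanachFunctionLattice μ) (p : ℝ) : Prop where
  one_le : 1 ≤ p
  norm_lpSum_le : ∀ (n : ℕ) (x : Fin n → X.Elem),
    ‖X.lpSum one_le x‖ ≤ (∑ k, ‖x k‖ ^ p) ^ (1 / p)

/-! ### The `p`-concavification -/

theorem absPow_one_div_absPow {p : ℝ} (hp : 1 ≤ p) (f : Ω →ₘ[μ] ℝ) :
    absPow (1 / p) (absPow p f) = |f| := by
  apply AEEqFun.ext
  filter_upwards [coeFn_absPow (1 / p) (absPow p f), coeFn_absPow p f, AEEqFun.coeFn_abs f]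
    with ω h1 h2 h3
  rw [h1, h2, h3, abs_of_nonneg (by positivity), one_div, Real.rpow_rpow_inv (abs_nonneg _)
    (by linarith)]

theorem abs_add_root_le {p : ℝ} (hp : 1 ≤ p) (f g : Ω →ₘ[μ] ℝ) :
    |absPow (1 / p) (f + g)| ≤ |lpSumL0 p ![absPow (1 / p) f, absPow (1 / p) g]| := by
  have hp0 : 0 < p := by linarith
  rw [abs_le_abs_iff_ae]
  filter_upwards [coeFn_absPow (1 / p) (f + g), AEEqFun.coeFn_add f g, coeFn_absPow (1 / p) f,
    coeFn_absPow (1 / p) g, coeFn_lpSumL0 p ![absPow (1 / p) f, absPow (1 / p) g]]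
    with ω h1 h2 h3 h4 h5
  have h6 : ∀ t : ℝ, |(|t| ^ (1 / p))| ^ p = |t| := fun t => by
    rw [abs_of_nonneg (by positivity), one_div, Real.rpow_inv_rpow (abs_nonneg _) hp0.ne']
  rw [h1, h5, Fin.sum_univ_two]
  simp only [Matrix.cons_val_zero, Matrix.cons_val_one, h3, h4, h2, Pi.add_apply, h6]
  rw [abs_of_nonneg (Real.rpow_nonneg (abs_nonneg _) _),
    abs_of_nonneg (Real.rpow_nonneg (add_nonneg (abs_nonneg _) (abs_nonneg _)) _)]
  exact Real.rpow_le_rpow (abs_nonneg _) (abs_add_le _ _) (by positivity)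

theorem absPow_smul {p : ℝ} (c : ℝ) (f : Ω →ₘ[μ] ℝ) :
    absPow (1 / p) (c • f) = (|c| ^ (1 / p)) • absPow (1 / p) f := by
  apply AEEqFun.ext
  filter_upwards [coeFn_absPow (1 / p) (c • f), AEEqFun.coeFn_smul c f, coeFn_absPow (1 / p) f,
    AEEqFun.coeFn_smul (|c| ^ (1 / p)) (absPow (1 / p) f)] with ω h1 h2 h3 h4
  rw [h1, h2, h4]
  simp only [Pi.smul_apply, smul_eq_mul, h3, abs_mul]
  rw [Real.mul_rpow (abs_nonneg _) (abs_nonneg _)]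

theorem absPow_zero {p : ℝ} (hp : 1 ≤ p) : absPow (1 / p) (0 : Ω →ₘ[μ] ℝ) = 0 := by
  have := absPow_smul (p := p) 0 (0 : Ω →ₘ[μ] ℝ)
  rw [abs_zero, Real.zero_rpow (by positivity)] at this
  simpa using this

/-- The `p`-concavification `X_p = {f ∈ L⁰(μ) : |f| ^ (1/p) ∈ X}`, as a subspace of `L⁰(μ)`. -/
def concavSubmodule (X : BanachFunctionLattice μ) {p : ℝ} (h : X.IsPConvex p) :
    Submodule ℝ (Ω →ₘ[μ] ℝ) where
  carrier := {f | absPow (1 / p) f ∈ X.toSubmodule}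
  zero_mem' := by
    change absPow (1 / p) 0 ∈ X.toSubmodule
    rw [absPow_zero h.one_le]
    exact X.toSubmodule.zero_mem
  add_mem' := fun {f g} hf hg => by
    refine mem_of_abs_le (X.lpSum h.one_le
      ![(⟨_, hf⟩ : X.toSubmodule), (⟨_, hg⟩ : X.toSubmodule)])
      ((abs_add_root_le h.one_le f g).trans (le_of_eq ?_))
    rw [toL0_lpSum]
    congr 2
    funext k
    fin_cases k <;> rfl
  smul_mem' := fun c f hf => by
    change absPow (1 / p) (c • f) ∈ X.toSubmodule
    rw [absPow_smul]
    exact X.toSubmodule.smul_mem _ hf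

/-- The elements of the `p`-concavification `X_p`. -/
def Concav (X : BanachFunctionLattice μ) {p : ℝ} (h : X.IsPConvex p) : Type _ :=
  X.concavSubmodule h

instance (X : BanachFunctionLattice μ) {p : ℝ} (h : X.IsPConvex p) : AddCommGroup (X.Concav h) :=
  inferInstanceAs (AddCommGroup (X.concavSubmodule h))

instance (X : BanachFunctionLattice μ) {p : ℝ} (h : X.IsPConvex p) : Module ℝ (X.Concav h) :=
  inferInstanceAs (Module ℝ (X.concavSubmodule h))

/-- The inclusion of `X_p` into `L⁰(μ)`. -/
def concavToL0 (X : BanachFunctionLattice μ) {p : ℝ} (h : X.IsPConvex p) :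
    X.Concav h →ₗ[ℝ] (Ω →ₘ[μ] ℝ) := (X.concavSubmodule h).subtype

/-- The element `|f| ^ (1/p)` of `X`, for `f ∈ X_p`. -/
def root {X : BanachFunctionLattice μ} {p : ℝ} (h : X.IsPConvex p) (f : X.Concav h) : X.Elem :=
  (⟨absPow (1 / p) (X.concavToL0 h f), f.property⟩ : X.toSubmodule)

/-- The norm `‖f‖ = ‖ |f| ^ (1/p) ‖_X ^ p` of `X_p`. -/
instance (X : BanachFunctionLattice μ) {p : ℝ} (h : X.IsPConvex p) : Norm (X.Concav h) :=
  ⟨fun f => ‖root h f‖ ^ p⟩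

theorem concav_norm_def {X : BanachFunctionLattice μ} {p : ℝ} (h : X.IsPConvex p)
    (f : X.Concav h) : ‖f‖ = ‖root h f‖ ^ p := rfl

theorem concavCore (X : BanachFunctionLattice μ) {p : ℝ} (h : X.IsPConvex p) :
    NormedSpace.Core ℝ (X.Concav h) where
  norm_nonneg f := Real.rpow_nonneg (norm_nonneg _) _
  norm_smul c f := by
    have hp0 : 0 < p := by linarith [h.one_le]
    have h1 : root h (c • f) = (|c| ^ (1 / p)) • root h f :=
      Subtype.ext (absPow_smul c _)
    rw [concav_norm_def, concav_norm_def, h1, norm_smul, Real.mul_rpow (by positivity)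
      (by positivity), Real.norm_of_nonneg (by positivity), one_div,
      Real.rpow_inv_rpow (abs_nonneg _) hp0.ne', Real.norm_eq_abs]
  norm_triangle f g := by
    have hp0 : 0 < p := by linarith [h.one_le]
    have h1 : ‖root h (f + g)‖ ≤ ‖X.lpSum h.one_le ![root h f, root h g]‖ := by
      refine norm_le_of_abs_le ((abs_add_root_le h.one_le _ _).trans (le_of_eq ?_))
      rw [toL0_lpSum]
      congr 2
      funext k
      fin_cases k <;> rfl
    have h2 := h1.trans (h.norm_lpSum_le 2 ![root h f, root h g])
    rw [Fin.sum_univ_two] at h2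
    simp only [Matrix.cons_val_zero, Matrix.cons_val_one] at h2
    rw [concav_norm_def, concav_norm_def, concav_norm_def]
    rw [one_div] at h2
    exact (Real.le_rpow_inv_iff_of_pos (by positivity) (by positivity) hp0).1 h2
  norm_eq_zero_iff f := by
    have hp0 : 0 < p := by linarith [h.one_le]
    rw [concav_norm_def, Real.rpow_eq_zero (norm_nonneg _) hp0.ne', norm_eq_zero]
    constructor
    · intro h0
      have h1 : absPow (1 / p) (X.concavToL0 h f) = 0 := congrArg Subtype.val h0
      refine Subtype.ext (AEEqFun.ext ?_)
      filter_upwards [coeFn_absPow (1 / p) (X.concavToL0 h f),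
        AEEqFun.coeFn_zero (α := Ω) (μ := μ) (β := ℝ)] with ω h2 h3
      rw [h1, h3] at h2
      have h4 := (Real.rpow_eq_zero (abs_nonneg _) (by positivity)).1 h2.symm
      have h5 : X.concavToL0 h f ω = 0 := abs_eq_zero.1 h4
      exact h5.trans h3.symm
    · rintro rfl
      exact Subtype.ext (absPow_zero h.one_le)

instance (X : BanachFunctionLattice μ) {p : ℝ} (h : X.IsPConvex p) :
    NormedAddCommGroup (X.Concav h) := NormedAddCommGroup.ofCore (X.concavCore h)

instance (X : BanachFunctionLattice μ) {p : ℝ} (h : X.IsPConvex p) :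
    NormedSpace ℝ (X.Concav h) := NormedSpace.ofCore (X.concavCore h)

/-- The element `|x| ^ p` of `X_p`, for `x ∈ X`. -/
def pow {X : BanachFunctionLattice μ} {p : ℝ} (h : X.IsPConvex p) (x : X.Elem) : X.Concav h :=
  (⟨absPow p (X.toL0 x), by
    change absPow (1 / p) (absPow p (X.toL0 x)) ∈ X.toSubmodule
    rw [absPow_one_div_absPow h.one_le]
    exact mem_of_abs_le x (abs_abs_le _)⟩ : X.concavSubmodule h)

/-! ### The dual ball of the `p`-concavification -/

/-- The closed unit ball of the dual `(X_p)^*`. -/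
def DualBall (X : BanachFunctionLattice μ) {p : ℝ} (h : X.IsPConvex p) : Type _ :=
  {φ : WeakDual ℝ (X.Concav h) // ‖WeakDual.toStrongDual φ‖ ≤ 1}

/-- The weak-star topology on the dual ball. -/
instance (X : BanachFunctionLattice μ) {p : ℝ} (h : X.IsPConvex p) :
    TopologicalSpace (X.DualBall h) :=
  inferInstanceAs (TopologicalSpace {φ : WeakDual ℝ (X.Concav h) // ‖WeakDual.toStrongDual φ‖ ≤ 1})

instance (X : BanachFunctionLattice μ) {p : ℝ} (h : X.IsPConvex p) :
    MeasurableSpace (X.DualBall h) := borel _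

instance (X : BanachFunctionLattice μ) {p : ℝ} (h : X.IsPConvex p) :
    BorelSpace (X.DualBall h) := ⟨rfl⟩

/-- The positive part of the dual ball. -/
def posBall (X : BanachFunctionLattice μ) {p : ℝ} (h : X.IsPConvex p) : Set (X.DualBall h) :=
  {φ | ∀ f : X.Concav h, 0 ≤ X.concavToL0 h f → 0 ≤ φ.1 f}

theorem continuous_eval (X : BanachFunctionLattice μ) {p : ℝ} (h : X.IsPConvex p)
    (f : X.Concav h) : Continuous fun φ : X.DualBall h => φ.1 f :=
  (WeakDual.eval_continuous f).comp continuous_subtype_val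

theorem isClosed_posBall (X : BanachFunctionLattice μ) {p : ℝ} (h : X.IsPConvex p) :
    IsClosed (X.posBall h) := by
  have : X.posBall h = ⋂ f : X.Concav h, ⋂ _ : 0 ≤ X.concavToL0 h f, {φ | 0 ≤ φ.1 f} := by
    ext φ; simp [posBall]
  rw [this]
  exact isClosed_iInter fun f => isClosed_iInter fun _ =>
    isClosed_le continuous_const (X.continuous_eval h f)

/-- The functional `‖x‖_{p,q,ν} = (∫_{B⁺} ⟨|x| ^ p, x^*⟩ ^ (q/p) dν(x^*)) ^ (1/q)` on `X`, where
`B⁺` is the positive part of the unit ball of `(X_p)^*`. -/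
def rho {X : BanachFunctionLattice μ} {p : ℝ} (h : X.IsPConvex p) (q : ℝ)
    (ν : ProbabilityMeasure (X.DualBall h)) (x : X.Elem) : ℝ :=
  (∫ φ in X.posBall h, (φ.1 (pow h x)) ^ (q / p) ∂(ν : Measure (X.DualBall h))) ^ (1 / q)

theorem pow_nonneg' {X : BanachFunctionLattice μ} {p : ℝ} (h : X.IsPConvex p) (x : X.Elem) :
    0 ≤ X.concavToL0 h (pow h x) := by
  rw [← AEEqFun.coeFn_le]
  filter_upwards [coeFn_absPow p (X.toL0 x), AEEqFun.coeFn_zero (α := Ω) (μ := μ) (β := ℝ)]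
    with ω h1 h2
  rw [h2]
  change _ ≤ (absPow p (X.toL0 x)) ω
  rw [h1]
  exact Real.rpow_nonneg (abs_nonneg _) _

theorem eval_pow_nonneg {X : BanachFunctionLattice μ} {p : ℝ} (h : X.IsPConvex p)
    {φ : X.DualBall h} (hφ : φ ∈ X.posBall h) (x : X.Elem) : 0 ≤ φ.1 (pow h x) :=
  hφ _ (pow_nonneg' h x)

theorem eval_mono {X : BanachFunctionLattice μ} {p : ℝ} (h : X.IsPConvex p)
    {φ : X.DualBall h} (hφ : φ ∈ X.posBall h) {f g : X.Concav h}
    (hfg : X.concavToL0 h f ≤ X.concavToL0 h g) : φ.1 f ≤ φ.1 g := by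
  have := hφ (g - f) (by
    rw [map_sub, ← AEEqFun.coeFn_le]
    filter_upwards [AEEqFun.coeFn_le.2 hfg, AEEqFun.coeFn_zero (α := Ω) (μ := μ) (β := ℝ),
      AEEqFun.coeFn_sub (X.concavToL0 h g) (X.concavToL0 h f)] with ω h1 h2 h3
    rw [h2, h3]
    exact sub_nonneg.2 h1)
  rw [map_sub] at this
  linarith

theorem pow_smul {X : BanachFunctionLattice μ} {p : ℝ} (h : X.IsPConvex p) (c : ℝ) (x : X.Elem) :
    pow h (c • x) = (|c| ^ p) • pow h x := by
  refine Subtype.ext (AEEqFun.ext ?_)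
  filter_upwards [coeFn_absPow p (X.toL0 (c • x)), AEEqFun.coeFn_smul c (X.toL0 x),
    coeFn_absPow p (X.toL0 x), AEEqFun.coeFn_smul (|c| ^ p) (absPow p (X.toL0 x))]
    with ω h1 h2 h3 h4
  refine h1.trans (Eq.trans ?_ h4.symm)
  rw [map_smul, h2]
  simp only [Pi.smul_apply, smul_eq_mul, h3, abs_mul]
  rw [Real.mul_rpow (abs_nonneg _) (abs_nonneg _)]

/-- Convexity of `t ↦ t ^ p`, in homogeneous form. -/
theorem convex_bound {p a b s t : ℝ} (hp : 1 ≤ p) (ha : 0 < a) (hb : 0 < b) :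
    |s + t| ^ p ≤ ((a + b) ^ p * (a / (a + b)) * (a ^ p)⁻¹) * |s| ^ p +
      ((a + b) ^ p * (b / (a + b)) * (b ^ p)⁻¹) * |t| ^ p := by
  have hab : 0 < a + b := by positivity
  have h1 : |s| / a ∈ Set.Ici (0 : ℝ) := Set.mem_Ici.2 (by positivity)
  have h2 : |t| / b ∈ Set.Ici (0 : ℝ) := Set.mem_Ici.2 (by positivity)
  have h3 : 0 ≤ a / (a + b) := by positivity
  have h4 : 0 ≤ b / (a + b) := by positivity
  have h := (convexOn_rpow hp).2 h1 h2 h3 h4 (by field_simp)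
  simp only [smul_eq_mul] at h
  have e : a / (a + b) * (|s| / a) + b / (a + b) * (|t| / b) = (|s| + |t|) / (a + b) := by
    field_simp
  rw [e, Real.div_rpow (by positivity) hab.le, Real.div_rpow (by positivity) ha.le,
    Real.div_rpow (by positivity) hb.le, div_le_iff₀ (by positivity)] at h
  calc |s + t| ^ p ≤ (|s| + |t|) ^ p := by gcongr; exact abs_add_le _ _
    _ ≤ _ := h
    _ = _ := by ring

theorem eval_pow_add_le {X : BanachFunctionLattice μ} {p : ℝ} (h : X.IsPConvex p)
    {φ : X.DualBall h} (hφ : φ ∈ X.posBall h) (x y : X.Elem) :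
    (φ.1 (pow h (x + y))) ^ (1 / p) ≤
      (φ.1 (pow h x)) ^ (1 / p) + (φ.1 (pow h y)) ^ (1 / p) := by
  have hp := h.one_le
  have hp0 : 0 < p := by linarith
  set A := (φ.1 (pow h x)) ^ (1 / p) with hA
  set B := (φ.1 (pow h y)) ^ (1 / p) with hB
  have hA0 : 0 ≤ A := Real.rpow_nonneg (eval_pow_nonneg h hφ x) _
  have hB0 : 0 ≤ B := Real.rpow_nonneg (eval_pow_nonneg h hφ y) _
  have hAp : φ.1 (pow h x) = A ^ p := by
    rw [hA, one_div, Real.rpow_inv_rpow (eval_pow_nonneg h hφ x) hp0.ne']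
  have hBp : φ.1 (pow h y) = B ^ p := by
    rw [hB, one_div, Real.rpow_inv_rpow (eval_pow_nonneg h hφ y) hp0.ne']
  refine le_of_forall_pos_le_add fun ε hε => ?_
  set a := A + ε / 2 with ha
  set b := B + ε / 2 with hb
  have ha0 : 0 < a := by positivity
  have hb0 : 0 < b := by positivity
  have key : φ.1 (pow h (x + y)) ≤ (a + b) ^ p := by
    have h1 : φ.1 (pow h (x + y)) ≤
        φ.1 (((a + b) ^ p * (a / (a + b)) * (a ^ p)⁻¹) • pow h x +
          ((a + b) ^ p * (b / (a + b)) * (b ^ p)⁻¹) • pow h y) := by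
      refine eval_mono h hφ ?_
      rw [map_add, map_smul, map_smul, ← AEEqFun.coeFn_le]
      filter_upwards [AEEqFun.coeFn_add
          (((a + b) ^ p * (a / (a + b)) * (a ^ p)⁻¹) • X.concavToL0 h (pow h x))
          (((a + b) ^ p * (b / (a + b)) * (b ^ p)⁻¹) • X.concavToL0 h (pow h y)),
        AEEqFun.coeFn_smul ((a + b) ^ p * (a / (a + b)) * (a ^ p)⁻¹) (X.concavToL0 h (pow h x)),
        AEEqFun.coeFn_smul ((a + b) ^ p * (b / (a + b)) * (b ^ p)⁻¹) (X.concavToL0 h (pow h y)),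
        coeFn_absPow p (X.toL0 x), coeFn_absPow p (X.toL0 y), coeFn_absPow p (X.toL0 (x + y)),
        AEEqFun.coeFn_add (X.toL0 x) (X.toL0 y)] with ω e1 e2 e3 e4 e5 e6 e7
      have e8 : X.toL0 (x + y) ω = X.toL0 x ω + X.toL0 y ω := by rw [map_add, e7]; rfl
      rw [e1, Pi.add_apply, e2, e3]
      change absPow p (X.toL0 (x + y)) ω ≤ _ * absPow p (X.toL0 x) ω + _ * absPow p (X.toL0 y) ω
      rw [e4, e5, e6, e8]
      exact convex_bound hp ha0 hb0
    rw [map_add, map_smul, map_smul, hAp, hBp, smul_eq_mul, smul_eq_mul] at h1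
    have hAa : (a ^ p)⁻¹ * A ^ p ≤ 1 := by
      rw [inv_mul_le_iff₀ (by positivity), mul_one]
      gcongr; linarith
    have hBb : (b ^ p)⁻¹ * B ^ p ≤ 1 := by
      rw [inv_mul_le_iff₀ (by positivity), mul_one]
      gcongr; linarith
    calc φ.1 (pow h (x + y)) ≤ _ := h1
      _ = (a + b) ^ p * (a / (a + b)) * ((a ^ p)⁻¹ * A ^ p) +
          (a + b) ^ p * (b / (a + b)) * ((b ^ p)⁻¹ * B ^ p) := by ring
      _ ≤ (a + b) ^ p * (a / (a + b)) * 1 + (a + b) ^ p * (b / (a + b)) * 1 := by gcongr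
      _ = (a + b) ^ p := by field_simp
  calc (φ.1 (pow h (x + y))) ^ (1 / p) ≤ a + b := by
        rw [one_div, Real.rpow_inv_le_iff_of_pos (eval_pow_nonneg h hφ _) (by positivity) hp0]
        exact key
    _ = A + B + ε := by rw [ha, hb]; ring

theorem rho_eq {X : BanachFunctionLattice μ} {p : ℝ} (h : X.IsPConvex p) {q : ℝ} (hq : 1 ≤ q)
    (ν : ProbabilityMeasure (X.DualBall h)) (x : X.Elem) :
    MemLp (fun φ : X.DualBall h => (φ.1 (pow h x)) ^ (1 / p)) (ENNReal.ofReal q)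
        ((ν : Measure (X.DualBall h)).restrict (X.posBall h)) ∧
      rho h q ν x = (eLpNorm (fun φ : X.DualBall h => (φ.1 (pow h x)) ^ (1 / p))
        (ENNReal.ofReal q) ((ν : Measure (X.DualBall h)).restrict (X.posBall h))).toReal := by
  have hp0 : 0 < p := by linarith [h.one_le]
  have hq0 : 0 < q := by linarith
  have hmem : MemLp (fun φ : X.DualBall h => (φ.1 (pow h x)) ^ (1 / p)) (ENNReal.ofReal q)
      ((ν : Measure (X.DualBall h)).restrict (X.posBall h)) := by
    refine MemLp.of_bound (C := ‖pow h x‖ ^ (1 / p)) ?_ ?_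
    · exact (((X.continuous_eval h (pow h x)).rpow_const
        (fun _ => Or.inr (by positivity))).measurable).aestronglyMeasurable
    · filter_upwards [ae_restrict_mem (X.isClosed_posBall h).measurableSet] with φ hφ
      have h0 := eval_pow_nonneg h hφ x
      rw [Real.norm_of_nonneg (Real.rpow_nonneg h0 _)]
      gcongr
      have h1 := (WeakDual.toStrongDual φ.1).le_of_opNorm_le φ.2 (pow h x)
      rw [one_mul] at h1
      exact (le_abs_self _).trans h1
  refine ⟨hmem, ?_⟩
  rw [hmem.eLpNorm_eq_integral_rpow_norm (by simpa using hq0) (by simp),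
    ENNReal.toReal_ofReal hq0.le, ENNReal.toReal_ofReal (by positivity), rho, one_div q]
  congr 1
  refine setIntegral_congr_fun (X.isClosed_posBall h).measurableSet fun φ hφ => ?_
  have h0 := eval_pow_nonneg h hφ x
  change _ = ‖(φ.1 (pow h x)) ^ (1 / p)‖ ^ q
  rw [Real.norm_of_nonneg (Real.rpow_nonneg h0 _), ← Real.rpow_mul h0]
  congr 1
  ring

theorem toReal_eLpNorm_le_add {α : Type*} [MeasurableSpace α] {ν : Measure α} {q : ℝ≥0∞}
    (hq : 1 ≤ q) {F G H : α → ℝ} (hF : MemLp F q ν) (hG : MemLp G q ν)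
    (h : ∀ᵐ a ∂ν, H a ≤ F a + G a ∧ 0 ≤ H a) :
    (eLpNorm H q ν).toReal ≤ (eLpNorm F q ν).toReal + (eLpNorm G q ν).toReal := by
  rw [← ENNReal.toReal_add hF.eLpNorm_ne_top hG.eLpNorm_ne_top]
  refine ENNReal.toReal_mono (ENNReal.add_ne_top.2 ⟨hF.eLpNorm_ne_top, hG.eLpNorm_ne_top⟩) ?_
  refine le_trans (eLpNorm_mono_ae (g := F + G) ?_)
    (eLpNorm_add_le hF.aestronglyMeasurable hG.aestronglyMeasurable hq)
  filter_upwards [h] with a ha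
  rw [Real.norm_of_nonneg ha.2]
  exact ha.1.trans (le_abs_self _)

theorem rho_add_le {X : BanachFunctionLattice μ} {p : ℝ} (h : X.IsPConvex p) {q : ℝ} (hq : 1 ≤ q)
    (ν : ProbabilityMeasure (X.DualBall h)) (x y : X.Elem) :
    rho h q ν (x + y) ≤ rho h q ν x + rho h q ν y := by
  obtain ⟨hx, ex⟩ := rho_eq h hq ν x
  obtain ⟨hy, ey⟩ := rho_eq h hq ν y
  obtain ⟨hxy, exy⟩ := rho_eq h hq ν (x + y)
  have hq' : 1 ≤ ENNReal.ofReal q := by simpa using hq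
  have hle : ∀ᵐ φ ∂((ν : Measure (X.DualBall h)).restrict (X.posBall h)),
      (φ.1 (pow h (x + y))) ^ (1 / p) ≤
        (φ.1 (pow h x)) ^ (1 / p) + (φ.1 (pow h y)) ^ (1 / p) ∧
      0 ≤ (φ.1 (pow h (x + y))) ^ (1 / p) := by
    filter_upwards [ae_restrict_mem (X.isClosed_posBall h).measurableSet] with φ hφ
    exact ⟨eval_pow_add_le h hφ x y, Real.rpow_nonneg (eval_pow_nonneg h hφ _) _⟩
  rw [ex, ey, exy]
  exact toReal_eLpNorm_le_add hq' hx hy hle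

theorem rho_smul {X : BanachFunctionLattice μ} {p : ℝ} (h : X.IsPConvex p) {q : ℝ} (hq : 1 ≤ q)
    (ν : ProbabilityMeasure (X.DualBall h)) (c : ℝ) (x : X.Elem) :
    rho h q ν (c • x) = ‖c‖ * rho h q ν x := by
  have hp0 : 0 < p := by linarith [h.one_le]
  have hq0 : 0 < q := by linarith
  have h1 : ∫ φ in X.posBall h, (φ.1 (pow h (c • x))) ^ (q / p) ∂(ν : Measure (X.DualBall h)) =
      |c| ^ q * ∫ φ in X.posBall h, (φ.1 (pow h x)) ^ (q / p) ∂(ν : Measure (X.DualBall h)) := by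
    rw [← integral_const_mul]
    refine setIntegral_congr_fun (X.isClosed_posBall h).measurableSet fun φ hφ => ?_
    have h0 := eval_pow_nonneg h hφ x
    change (φ.1 (pow h (c • x))) ^ (q / p) = _
    rw [pow_smul, map_smul, smul_eq_mul, Real.mul_rpow (by positivity) h0,
      ← Real.rpow_mul (abs_nonneg _)]
    congr 2
    field_simp
  rw [rho, h1, Real.mul_rpow (by positivity), ← rho, one_div, Real.rpow_rpow_inv (abs_nonneg _)
    hq0.ne', Real.norm_eq_abs]
  exact setIntegral_nonneg (X.isClosed_posBall h).measurableSet fun φ hφ =>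
    Real.rpow_nonneg (eval_pow_nonneg h hφ x) _

/-- `‖·‖_{p,q,ν}` as a seminorm on `X`. -/
def rhoSeminorm {X : BanachFunctionLattice μ} {p q : ℝ} (h : X.IsPConvex p) (hpq : p ≤ q)
    (ν : ProbabilityMeasure (X.DualBall h)) : Seminorm ℝ X.Elem :=
  Seminorm.of (rho h q ν) (rho_add_le h (h.one_le.trans hpq) ν) (rho_smul h (h.one_le.trans hpq) ν)

/-- The seminormed space `F_{X_p}^q(ν) = (X, ‖·‖_{p,q,ν})`. -/
def FSpace (X : BanachFunctionLattice μ) {p q : ℝ} (h : X.IsPConvex p) (_hpq : p ≤ q)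
    (_ν : ProbabilityMeasure (X.DualBall h)) : Type _ := X.Elem

instance (X : BanachFunctionLattice μ) {p q : ℝ} (h : X.IsPConvex p) (hpq : p ≤ q)
    (ν : ProbabilityMeasure (X.DualBall h)) : SeminormedAddCommGroup (X.FSpace h hpq ν) :=
  (rhoSeminorm h hpq ν).toAddGroupSeminorm.toSeminormedAddCommGroup

instance (X : BanachFunctionLattice μ) {p q : ℝ} (h : X.IsPConvex p) (hpq : p ≤ q)
    (ν : ProbabilityMeasure (X.DualBall h)) : NormedSpace ℝ (X.FSpace h hpq ν) where
  toModule := inferInstanceAs (Module ℝ X.Elem)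
  norm_smul_le c x := (map_smul_eq_mul (rhoSeminorm h hpq ν) c x).le

/-- The Banach space `F̃_{X_p}^q(ν)`: the completion of the quotient of `(X, ‖·‖_{p,q,ν})` by the
null space of `‖·‖_{p,q,ν}`. -/
abbrev FTilde (X : BanachFunctionLattice μ) {p q : ℝ} (h : X.IsPConvex p) (hpq : p ≤ q)
    (ν : ProbabilityMeasure (X.DualBall h)) : Type _ :=
  UniformSpace.Completion (SeparationQuotient (X.FSpace h hpq ν))

theorem norm_pow {X : BanachFunctionLattice μ} {p : ℝ} (h : X.IsPConvex p) (x : X.Elem) :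
    ‖pow h x‖ = ‖x‖ ^ p := by
  have e : X.toL0 (root h (pow h x)) = |X.toL0 x| := absPow_one_div_absPow h.one_le _
  have h1 : ∀ᵐ ω ∂μ, |X.toL0 (root h (pow h x)) ω| = |X.toL0 x ω| := by
    filter_upwards [AEEqFun.coeFn_abs (X.toL0 x)] with ω h2
    rw [e, h2, abs_abs]
  rw [concav_norm_def]
  congr 1
  exact le_antisymm (norm_le_of_abs_le (abs_le_abs_iff_ae.2 (h1.mono fun ω hω => hω.le)))
    (norm_le_of_abs_le (abs_le_abs_iff_ae.2 (h1.mono fun ω hω => hω.ge)))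

theorem rho_le_norm {X : BanachFunctionLattice μ} {p : ℝ} (h : X.IsPConvex p) {q : ℝ}
    (hq : 1 ≤ q) (ν : ProbabilityMeasure (X.DualBall h)) (x : X.Elem) : rho h q ν x ≤ ‖x‖ := by
  have hp0 : 0 < p := by linarith [h.one_le]
  have hq0 : 0 < q := by linarith
  have h1 : ∀ φ ∈ X.posBall h, ‖(φ.1 (pow h x)) ^ (q / p)‖ ≤ ‖x‖ ^ q := fun φ hφ => by
    have h0 := eval_pow_nonneg h hφ x
    have h2 := (WeakDual.toStrongDual φ.1).le_of_opNorm_le φ.2 (pow h x)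
    rw [one_mul, norm_pow] at h2
    have h3 : φ.1 (pow h x) ≤ ‖x‖ ^ p := (le_abs_self _).trans h2
    rw [Real.norm_of_nonneg (Real.rpow_nonneg h0 _)]
    refine (Real.rpow_le_rpow h0 h3 (by positivity)).trans (le_of_eq ?_)
    rw [← Real.rpow_mul (norm_nonneg _)]
    congr 1
    field_simp
  have h4 := norm_setIntegral_le_of_norm_le_const
    (measure_lt_top (ν : Measure (X.DualBall h)) (X.posBall h)) h1
  have h5 : ∫ φ in X.posBall h, (φ.1 (pow h x)) ^ (q / p) ∂(ν : Measure (X.DualBall h)) ≤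
      ‖x‖ ^ q :=
    (le_abs_self _).trans (h4.trans (mul_le_of_le_one_right (by positivity) measureReal_le_one))
  rw [rho, one_div, Real.rpow_inv_le_iff_of_pos _ (norm_nonneg _) hq0]
  · exact h5
  · exact setIntegral_nonneg (X.isClosed_posBall h).measurableSet fun φ hφ =>
      Real.rpow_nonneg (eval_pow_nonneg h hφ x) _

/-- The canonical bounded linear map `ι_X : X → F̃_{X_p}^q(ν)`, `x ↦ [x]`. -/
def iota (X : BanachFunctionLattice μ) {p q : ℝ} (h : X.IsPConvex p) (hpq : p ≤ q)
    (ν : ProbabilityMeasure (X.DualBall h)) : X.Elem →L[ℝ] X.FTilde h hpq ν :=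
  LinearMap.mkContinuous
    { toFun := fun x =>
        ((SeparationQuotient.mk (show X.FSpace h hpq ν from x) :
          SeparationQuotient (X.FSpace h hpq ν)) : X.FTilde h hpq ν)
      map_add' := fun x y => UniformSpace.Completion.coe_add
        (SeparationQuotient.mk (show X.FSpace h hpq ν from x))
        (SeparationQuotient.mk (show X.FSpace h hpq ν from y))
      map_smul' := fun c x => UniformSpace.Completion.coe_smul c
        (SeparationQuotient.mk (show X.FSpace h hpq ν from x)) } 1 (fun x => by
    rw [one_mul]
    refine (le_of_eq ?_).trans (rho_le_norm h (h.one_le.trans hpq) ν x)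
    refine (UniformSpace.Completion.norm_coe _).trans ?_
    rw [SeparationQuotient.norm_mk]
    rfl)

theorem norm_iota (X : BanachFunctionLattice μ) {p q : ℝ} (h : X.IsPConvex p) (hpq : p ≤ q)
    (ν : ProbabilityMeasure (X.DualBall h)) (x : X.Elem) :
    ‖X.iota h hpq ν x‖ = rho h q ν x := by
  refine (UniformSpace.Completion.norm_coe _).trans ?_
  rw [SeparationQuotient.norm_mk]
  rfl

/-! ### Strongly concave multilinear maps -/

/-- The exponent `r ∈ (1, ∞]` with `1/r = 1/p - 1/q`; it is `∞` when `p = q`. -/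
def strongExponent (p q : ℝ) : ℝ≥0∞ := (ENNReal.ofReal (1 / p - 1 / q))⁻¹

/-- `sup ‖(∑ₖ |βₖ xₖ| ^ p) ^ (1/p)‖_X` over all `β` in the unit ball of `ℓ_rⁿ`, `1/r = 1/p - 1/q`. -/
def strongSup (X : BanachFunctionLattice μ) {p : ℝ} (hp : 1 ≤ p) (q : ℝ) {n : ℕ}
    (x : Fin n → X.Elem) : ℝ :=
  ⨆ β : {β : PiLp (strongExponent p q) (fun _ : Fin n => ℝ) // ‖β‖ ≤ 1},
    ‖X.lpSum hp (fun k => β.1 k • x k)‖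

/-- The supremum in `strongSup` is over a bounded set of real numbers. -/
theorem bddAbove_strongSup (X : BanachFunctionLattice μ) {p : ℝ} (hp : 1 ≤ p) {q : ℝ}
    (hpq : p ≤ q) {n : ℕ} (x : Fin n → X.Elem) :
    BddAbove (Set.range fun β : {β : PiLp (strongExponent p q) (fun _ : Fin n => ℝ) // ‖β‖ ≤ 1} =>
      ‖X.lpSum hp (fun k => β.1 k • x k)‖) := by
  have hp0 : 0 < p := by linarith
  have hr : Fact (1 ≤ strongExponent p q) := ⟨by
    rw [strongExponent, ENNReal.one_le_inv, ENNReal.ofReal_le_one]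
    have h1 : 1 / p ≤ 1 := by rw [div_le_one hp0]; exact hp
    have h2 : 0 ≤ 1 / q := one_div_nonneg.2 (hp0.le.trans hpq)
    linarith⟩
  refine ⟨‖X.lpSum hp x‖, ?_⟩
  rintro _ ⟨β, rfl⟩
  refine norm_le_of_abs_le (abs_le_abs_iff_ae.2 ?_)
  have h : ∀ᵐ ω ∂μ, ∀ k, X.toL0 (β.1 k • x k) ω = β.1 k * X.toL0 (x k) ω :=
    ae_all_iff.2 fun k => by
      rw [map_smul]
      exact AEEqFun.coeFn_smul (β.1 k) (X.toL0 (x k))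
  rw [toL0_lpSum, toL0_lpSum]
  filter_upwards [coeFn_lpSumL0 p (fun k => X.toL0 (x k)),
    coeFn_lpSumL0 p (fun k => X.toL0 (β.1 k • x k)), h] with ω h1 h2 h3
  rw [h1, h2, abs_of_nonneg (by positivity), abs_of_nonneg (by positivity)]
  refine Real.rpow_le_rpow (by positivity) (Finset.sum_le_sum fun k _ => ?_) (by positivity)
  refine Real.rpow_le_rpow (abs_nonneg _) ?_ hp0.le
  rw [h3, abs_mul]
  exact mul_le_of_le_one_left (abs_nonneg _) ((PiLp.norm_apply_le β.1 k).trans β.2)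

end BanachFunctionLattice

/-- `T` is `(p₁,…,p_m)`-strongly `(q₁,…,q_m)`-concave; `s` is the number given by
`1/s = 1/q₁ + ⋯ + 1/q_m`. -/
def IsStronglyConcave {m : ℕ} {Ω : Fin m → Type*} [∀ j, MeasurableSpace (Ω j)]
    {μ : ∀ j, Measure (Ω j)} (X : ∀ j, BanachFunctionLattice (μ j)) {Y : Type*}
    [NormedAddCommGroup Y] [NormedSpace ℝ Y] {p : Fin m → ℝ} (hp : ∀ j, 1 ≤ p j)
    (q : Fin m → ℝ) (s : ℝ) (T : MultilinearMap ℝ (fun j => (X j).Elem) Y) : Prop :=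
  ∃ C > 0, ∀ (n : ℕ) (x : ∀ j, Fin n → (X j).Elem),
    (∑ k, ‖T (fun j => x j k)‖ ^ s) ^ (1 / s) ≤ C * ∏ j, (X j).strongSup (hp j) (q j) (x j)

end

/-! Both conditions are equivalent to the Pietsch domination `‖T x‖ ≤ C ∏ ρ_j(x_j)`, where `ρ_j` is
the seminorm `rho` of `ν_j`. Since `ρ_j(x_j)` is the norm of `ι(x_j)` and the range of `ι` is dense,
a dominated `T` extends to a bounded `S` (`MultilinearMap.exists_continuous_factor`). Conversely,
boundedness of `S` is a domination of `T`.

The link with concavity is a formula for `strongSup`. The `p`-th power of `‖(∑|β_k x_k|^p)^(1/p)‖`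
is the norm in `X_p` of `∑ |β_k|^p |x_k|^p`, and a positive functional attains it. Hölder duality
between `ℓ_r` and `ℓ_{q/p}` is sharp, so `strongSup ^ q` is the maximum over positive `φ` in the
dual ball of `∑ φ(|x_k|^p)^(q/p)`. The two inequalities are `sum_eval_pow_rpow_le_strongSup` and
`exists_strongSup_le`.

From domination to concavity, integrate the first inequality against `ν_j` and apply Hölder with the
weights `s/q_j`, which sum to one.

From concavity to domination, each `x` defines a continuous function `defect` on the product of the
positive balls. By the second inequality and AM-GM, every finite sum of defects is nonpositive
somewhere. Defects are stable under nonnegative multiples, so this passes to their convex hull, and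
Hahn-Banach yields a state that is nonpositive on all of them. By the Riesz theorem its marginals
are measures `ν_j` with `‖T x‖^s ≤ C^s ∑ (s/q_j) ρ_j(x_j)^(q_j)`. Rescaling each variable turns this
sum into the product. -/

noncomputable section

/-! ### Finite Hölder inequalities and their equality case. -/

/-- Hölder's inequality for finitely many nonnegative sequences, with weights of sum one. -/
theorem Real.sum_prod_rpow_le {ι κ : Type*} [Fintype ι] [Fintype κ] {w : ι → ℝ}
    (hw : ∀ i, 0 < w i) (hw1 : ∑ i, w i = 1) {b : ι → κ → ℝ} (hb : ∀ i k, 0 ≤ b i k) :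
    ∑ k, ∏ i, b i k ^ w i ≤ ∏ i, (∑ k, b i k) ^ w i := by
  have hS : ∀ i, 0 ≤ ∑ k, b i k := fun i => Finset.sum_nonneg fun k _ => hb i k
  by_cases h : ∃ i, ∑ k, b i k = 0
  · obtain ⟨i, hi⟩ := h
    have h0 : ∀ k, b i k = 0 := fun k =>
      (Finset.sum_eq_zero_iff_of_nonneg fun k _ => hb i k).1 hi k (Finset.mem_univ k)
    rw [Finset.sum_eq_zero fun k _ => Finset.prod_eq_zero (Finset.mem_univ i)
      (by rw [h0, Real.zero_rpow (hw i).ne'])]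
    exact Finset.prod_nonneg fun i _ => Real.rpow_nonneg (hS i) _
  · push Not at h
    have hS' : ∀ i, 0 < ∑ k, b i k := fun i => (hS i).lt_of_ne' (h i)
    have hP : 0 < ∏ i, (∑ k, b i k) ^ w i :=
      Finset.prod_pos fun i _ => Real.rpow_pos_of_pos (hS' i) _
    -- Normalise every sequence to total mass one; weighted AM-GM for each `k` then sums to one.
    rw [← div_le_one hP, Finset.sum_div]
    calc ∑ k, (∏ i, b i k ^ w i) / ∏ i, (∑ k, b i k) ^ w i
        = ∑ k, ∏ i, (b i k / ∑ k, b i k) ^ w i := by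
          refine Finset.sum_congr rfl fun k _ => ?_
          rw [← Finset.prod_div_distrib]
          exact Finset.prod_congr rfl fun i _ => (Real.div_rpow (hb i k) (hS i) _).symm
      _ ≤ ∑ k, ∑ i, w i * (b i k / ∑ k, b i k) :=
          Finset.sum_le_sum fun k _ => Real.geom_mean_le_arith_mean_weighted _ _ _
            (fun i _ => (hw i).le) hw1 fun i _ => div_nonneg (hb i k) (hS i)
      _ = 1 := by
          rw [Finset.sum_comm, ← hw1]
          refine Finset.sum_congr rfl fun i _ => ?_
          rw [← Finset.mul_sum, ← Finset.sum_div, div_self (h i), mul_one]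

namespace BanachFunctionLattice

theorem strongExponent_self (p : ℝ) : strongExponent p p = ∞ := by
  simp [strongExponent]

theorem inv_sub_inv_pos {p q : ℝ} (hp : 1 ≤ p) (hpq : p < q) : 0 < 1 / p - 1 / q :=
  sub_pos.2 (one_div_lt_one_div_of_lt (by linarith) hpq)

theorem strongExponent_toReal {p q : ℝ} (hp : 1 ≤ p) (hpq : p < q) :
    (strongExponent p q).toReal = (1 / p - 1 / q)⁻¹ := by
  rw [strongExponent, ENNReal.toReal_inv, ENNReal.toReal_ofReal (inv_sub_inv_pos hp hpq).le]

theorem norm_le_one_iff_sum_rpow_le_one {p q : ℝ} (hp : 1 ≤ p) (hpq : p < q) {n : ℕ}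
    (β : PiLp (strongExponent p q) (fun _ : Fin n => ℝ)) :
    ‖β‖ ≤ 1 ↔ ∑ k, |β k| ^ (1 / p - 1 / q)⁻¹ ≤ 1 := by
  have hr := inv_sub_inv_pos hp hpq
  rw [PiLp.norm_eq_sum (by rw [strongExponent_toReal hp hpq]; positivity),
    strongExponent_toReal hp hpq, one_div _⁻¹, inv_inv]
  simp only [Real.norm_eq_abs]
  refine ⟨fun h => ?_, fun h => Real.rpow_le_one (by positivity) h hr.le⟩
  by_contra! h1
  exact h.not_gt (Real.one_lt_rpow h1 hr)

/-- Hölder's inequality between the unit ball of `ℓ_r`, `1/r = 1/p - 1/q`, and `ℓ_{q/p}`. -/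
theorem sum_abs_rpow_mul_le {p q : ℝ} (hp : 1 ≤ p) (hpq : p ≤ q) {n : ℕ}
    {β : PiLp (strongExponent p q) (fun _ : Fin n => ℝ)} (hβ : ‖β‖ ≤ 1) {a : Fin n → ℝ}
    (ha : ∀ k, 0 ≤ a k) :
    ∑ k, |β k| ^ p * a k ≤ (∑ k, a k ^ (q / p)) ^ (p / q) := by
  have hp0 : 0 < p := by linarith
  rcases hpq.eq_or_lt with rfl | hlt
  · have hr : Fact (1 ≤ strongExponent p p) := ⟨by rw [strongExponent_self]; exact le_top⟩
    rw [div_self hp0.ne']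
    simp only [Real.rpow_one]
    refine Finset.sum_le_sum fun k _ => mul_le_of_le_one_left (ha k) ?_
    exact Real.rpow_le_one (abs_nonneg _) ((PiLp.norm_apply_le β k).trans hβ) hp0.le
  · have hq0 : 0 < q := by linarith
    have hr := inv_sub_inv_pos hp hlt
    -- With `r = (1/p - 1/q)⁻¹` this is `p/r + p/q = 1`.
    have hconj : ((1 / p - 1 / q)⁻¹ / p).HolderConjugate (q / p) := by
      refine Real.holderConjugate_iff.2 ⟨?_, ?_⟩
      · rw [lt_div_iff₀ hp0, one_mul, lt_inv_comm₀ hp0 hr, ← one_div]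
        linarith [one_div_pos.2 hq0]
      · field_simp
        ring
    refine (Real.inner_le_Lp_mul_Lq_of_nonneg _ hconj
      (fun k _ => Real.rpow_nonneg (abs_nonneg _) _) fun k _ => ha k).trans ?_
    rw [one_div_div, one_div_div]
    refine mul_le_of_le_one_left (Real.rpow_nonneg
      (Finset.sum_nonneg fun k _ => Real.rpow_nonneg (ha k) _) _) ?_
    refine Real.rpow_le_one (by positivity) ?_ (by positivity)
    refine le_of_eq_of_le ?_ ((norm_le_one_iff_sum_rpow_le_one hp hlt β).1 hβ)
    refine Finset.sum_congr rfl fun k _ => ?_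
    rw [← Real.rpow_mul (abs_nonneg _), mul_div_cancel₀ _ hp0.ne']

/-- Equality is attained in `sum_abs_rpow_mul_le`. -/
theorem exists_sum_abs_rpow_mul_eq {p q : ℝ} (hp : 1 ≤ p) (hpq : p ≤ q) {n : ℕ}
    {a : Fin n → ℝ} (ha : ∀ k, 0 ≤ a k) :
    ∃ β : PiLp (strongExponent p q) (fun _ : Fin n => ℝ), ‖β‖ ≤ 1 ∧
      ∑ k, |β k| ^ p * a k = (∑ k, a k ^ (q / p)) ^ (p / q) := by
  have hp0 : 0 < p := by linarith
  have hq0 : 0 < q := by linarith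
  rcases hpq.eq_or_lt with rfl | hlt
  · refine ⟨WithLp.toLp _ fun _ => 1, ?_, by simp [div_self hp0.ne']⟩
    -- The exponent occurs in the type of `β`, so it is first made a variable that can be replaced
    -- by `∞`.
    have key : ∀ r : ℝ≥0∞, r = ∞ →
        ‖(WithLp.toLp r fun _ => 1 : PiLp r (fun _ : Fin n => ℝ))‖ ≤ 1 := by
      rintro r rfl
      rw [PiLp.norm_toLp, pi_norm_le_iff_of_nonneg zero_le_one]
      simp
    exact key _ (strongExponent_self p)
  · have hr := inv_sub_inv_pos hp hlt
    set t := 1 / p - 1 / q with ht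
    have hb : ∀ k, 0 ≤ a k ^ (q / p) := fun k => Real.rpow_nonneg (ha k) _
    set S := ∑ k, a k ^ (q / p) with hS
    have hS0 : 0 ≤ S := Finset.sum_nonneg fun k _ => hb k
    rcases hS0.eq_or_lt with h0 | h0
    · refine ⟨WithLp.toLp _ fun _ => 0, ?_, ?_⟩
      · rw [norm_le_one_iff_sum_rpow_le_one hp hlt]
        change ∑ _k : Fin n, |(0 : ℝ)| ^ t⁻¹ ≤ 1
        simp [Real.zero_rpow (inv_pos.2 hr).ne']
      · rw [← h0, Real.zero_rpow (by positivity)]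
        simp [Real.zero_rpow hp0.ne']
    -- The equality case of Hölder: `|β_k|^r` is proportional to `a_k^(q/p)`, and division by `S`
    -- makes its sum one. Here `t = 1/r`.
    · refine ⟨WithLp.toLp _ fun k => (a k ^ (q / p) / S) ^ t, ?_, ?_⟩
      · rw [norm_le_one_iff_sum_rpow_le_one hp hlt]
        refine le_of_eq ?_
        calc _ = ∑ k, a k ^ (q / p) / S := by
              refine Finset.sum_congr rfl fun k _ => ?_
              have h1 : 0 ≤ a k ^ (q / p) / S := div_nonneg (hb k) hS0
              change |(a k ^ (q / p) / S) ^ t| ^ t⁻¹ = _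
              rw [abs_of_nonneg (Real.rpow_nonneg h1 _), Real.rpow_rpow_inv h1 hr.ne']
          _ = 1 := by rw [← Finset.sum_div, div_self h0.ne']
      · have htp : t * p = 1 - p / q := by rw [ht]; field_simp
        calc _ = ∑ k, a k ^ (q / p) / S ^ (t * p) := by
              refine Finset.sum_congr rfl fun k _ => ?_
              have h1 : 0 ≤ a k ^ (q / p) / S := div_nonneg (hb k) hS0
              change |(a k ^ (q / p) / S) ^ t| ^ p * a k = _
              rw [abs_of_nonneg (Real.rpow_nonneg h1 _), ← Real.rpow_mul h1,
                Real.div_rpow (hb k) hS0, ← Real.rpow_mul (ha k), div_mul_eq_mul_div]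
              congr 1
              have h2 : q / p * (t * p) + 1 = q / p := by rw [htp]; field_simp; ring
              have h3 : (0 : ℝ) < q / p := by positivity
              conv_rhs => rw [← h2, Real.rpow_add' (ha k) (by rw [h2]; exact h3.ne'),
                Real.rpow_one]
          _ = S ^ (p / q) := by
              rw [← Finset.sum_div, ← hS, htp, Real.rpow_sub h0, Real.rpow_one]
              have := Real.rpow_pos_of_pos h0 (p / q)
              field_simp

end BanachFunctionLattice

/-! ### Extension of multilinear maps, and representation of states on `C(K)`. -/

/-- A multilinear map into a Banach space that is bounded with respect to linear maps of dense
range into normed spaces factors through these maps. -/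
theorem MultilinearMap.exists_continuous_factor {m : ℕ} {E F : Fin m → Type*}
    [∀ j, AddCommGroup (E j)] [∀ j, Module ℝ (E j)] [∀ j, NormedAddCommGroup (F j)]
    [∀ j, NormedSpace ℝ (F j)] {Y : Type*} [NormedAddCommGroup Y] [NormedSpace ℝ Y]
    [CompleteSpace Y] (e : ∀ j, E j →ₗ[ℝ] F j) (he : ∀ j, DenseRange (e j))
    (T : MultilinearMap ℝ E Y) {C : ℝ} (hC : 0 ≤ C)
    (hT : ∀ x, ‖T x‖ ≤ C * ∏ j, ‖e j (x j)‖) :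
    ∃ S : ContinuousMultilinearMap ℝ F Y, ‖S‖ ≤ C ∧ ∀ x, S (fun j => e j (x j)) = T x := by
  induction m generalizing C with
  | zero =>
    refine ⟨ContinuousMultilinearMap.constOfIsEmpty ℝ F (T 0), ?_, fun x => ?_⟩
    · simpa using hT 0
    · simp [Subsingleton.elim x 0]
  | succ m ih =>
    -- Freezing the first variable at `a` leaves a map of one variable fewer with constant `C ‖e 0
    -- a‖`. The induction hypothesis extends it with that same bound on its norm.
    have hbound : ∀ a x, ‖T.curryLeft a x‖ ≤ (C * ‖e 0 a‖) * ∏ j, ‖e (Fin.succ j) (x j)‖ := by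
      intro a x
      have := hT (Fin.cons a x)
      rw [Fin.prod_univ_succ, ← mul_assoc] at this
      simpa using this
    choose A hA hAe using fun a => ih (fun j => e j.succ) (fun j => he j.succ) (T.curryLeft a)
      (by positivity) (hbound a)
    have hdense : DenseRange fun (x : ∀ j : Fin m, E j.succ) (j : Fin m) => e j.succ (x j) :=
      DenseRange.piMap fun j => he j.succ
    -- The extensions `A a` are merely chosen; uniqueness on a dense set forces them to depend
    -- linearly on `a`.
    have huniq : ∀ S₁ S₂ : ContinuousMultilinearMap ℝ (fun j : Fin m => F j.succ) Y,
        (∀ x : ∀ j : Fin m, E j.succ, S₁ (fun j => e j.succ (x j)) =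
          S₂ (fun j => e j.succ (x j))) → S₁ = S₂ := fun S₁ S₂ h =>
      DFunLike.coe_injective (hdense.equalizer S₁.cont S₂.cont (funext h))
    let A' : E 0 →ₗ[ℝ] ContinuousMultilinearMap ℝ (fun j : Fin m => F j.succ) Y :=
      { toFun := A
        map_add' := fun a b => huniq _ _ fun x => by
          rw [add_apply, hAe, hAe, hAe, map_add,
            add_apply]
        map_smul' := fun c a => huniq _ _ fun x => by
          rw [RingHom.id_apply, smul_apply, hAe, hAe, map_smul,
            smul_apply] }
    -- The bound `‖A a‖ ≤ C ‖e 0 a‖` lets `A'` extend along `e 0` to the first factor as well.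
    refine ⟨(A'.extendOfNorm (e 0)).uncurryLeft, ?_, fun x => ?_⟩
    · rw [ContinuousLinearMap.uncurryLeft_norm]
      exact LinearMap.opNorm_extendOfNorm_le (he 0) hC hA
    · rw [ContinuousLinearMap.uncurryLeft_apply,
        LinearMap.extendOfNorm_eq (f := A') (he 0) ⟨C, hA⟩]
      refine (hAe (x 0) (Fin.tail x)).trans ?_
      rw [MultilinearMap.curryLeft_apply, Fin.cons_self_tail]

/-- The Riesz representation theorem for states on `C(K)`, `K` compact. -/
theorem ContinuousMap.exists_regular_probabilityMeasure {K : Type*} [TopologicalSpace K]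
    [CompactSpace K] [T2Space K] [MeasurableSpace K] [BorelSpace K] (Λ : C(K, ℝ) →ₗ[ℝ] ℝ)
    (hΛ : ∀ f, 0 ≤ f → 0 ≤ Λ f) (h1 : Λ 1 = 1) :
    ∃ ν : ProbabilityMeasure K, (ν : Measure K).Regular ∧
      ∀ f : C(K, ℝ), ∫ x, f x ∂(ν : Measure K) = Λ f := by
  let Φ : CompactlySupportedContinuousMap K ℝ →ₚ[ℝ] ℝ :=
    { toFun := fun f => Λ f.toContinuousMap
      map_add' := fun f g => Λ.map_add f.toContinuousMap g.toContinuousMap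
      map_smul' := fun c f => Λ.map_smul c f.toContinuousMap
      monotone' := fun f g hfg => by
        have := hΛ (g.toContinuousMap - f.toContinuousMap) (fun x => sub_nonneg.2 (hfg x))
        rw [map_sub] at this
        exact sub_nonneg.1 this }
  have hint : ∀ f : C(K, ℝ), ∫ x, f x ∂(RealRMK.rieszMeasure Φ) = Λ f := fun f =>
    RealRMK.integral_rieszMeasure Φ (CompactlySupportedContinuousMap.continuousMapEquiv f)
  have hprob : IsProbabilityMeasure (RealRMK.rieszMeasure Φ) := by
    have := hint 1
    rw [h1] at this
    simp only [ContinuousMap.one_apply, integral_const, smul_eq_mul, mul_one] at this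
    refine ⟨?_⟩
    rw [← ENNReal.ofReal_toReal (measure_ne_top _ Set.univ)]
    change ENNReal.ofReal ((RealRMK.rieszMeasure Φ).real Set.univ) = 1
    rw [this, ENNReal.ofReal_one]
  exact ⟨⟨RealRMK.rieszMeasure Φ, hprob⟩, RealRMK.regular_rieszMeasure Φ, hint⟩

/-! ### Positive functionals on `X_p` and the dual formula for `strongSup`. -/

namespace BanachFunctionLattice

variable {Ω : Type*} [MeasurableSpace Ω] {μ : Measure Ω}

theorem concav_norm_le_of_abs_le {X : BanachFunctionLattice μ} {p : ℝ} (h : X.IsPConvex p)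
    {f g : X.Concav h} (hfg : ∀ᵐ ω ∂μ, |X.concavToL0 h f ω| ≤ |X.concavToL0 h g ω|) :
    ‖f‖ ≤ ‖g‖ := by
  have hp0 : 0 < p := by linarith [h.one_le]
  rw [concav_norm_def, concav_norm_def]
  refine Real.rpow_le_rpow (norm_nonneg _) (norm_le_of_abs_le (abs_le_abs_iff_ae.2 ?_)) hp0.le
  change ∀ᵐ ω ∂μ, |absPow (1 / p) (X.concavToL0 h f) ω| ≤ |absPow (1 / p) (X.concavToL0 h g) ω|
  filter_upwards [hfg, coeFn_absPow (1 / p) (X.concavToL0 h f),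
    coeFn_absPow (1 / p) (X.concavToL0 h g)] with ω h1 h2 h3
  rw [h2, h3, abs_of_nonneg (Real.rpow_nonneg (abs_nonneg _) _),
    abs_of_nonneg (Real.rpow_nonneg (abs_nonneg _) _)]
  exact Real.rpow_le_rpow (abs_nonneg _) h1 (by positivity)

/-- The positive part of an element of `X_p`. -/
def concavPosPart {X : BanachFunctionLattice μ} {p : ℝ} (h : X.IsPConvex p) (f : X.Concav h) :
    X.Concav h :=
  (⟨X.concavToL0 h f ⊔ 0, by
    have hp0 : 0 < p := by linarith [h.one_le]
    refine mem_of_abs_le (root h f) (abs_le_abs_iff_ae.2 ?_)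
    change ∀ᵐ ω ∂μ, |absPow (1 / p) (X.concavToL0 h f ⊔ 0) ω| ≤
      |absPow (1 / p) (X.concavToL0 h f) ω|
    filter_upwards [coeFn_absPow (1 / p) (X.concavToL0 h f),
      coeFn_absPow (1 / p) (X.concavToL0 h f ⊔ 0), AEEqFun.coeFn_sup (X.concavToL0 h f) 0,
      AEEqFun.coeFn_zero (α := Ω) (μ := μ) (β := ℝ)] with ω h1 h2 h3 h4
    rw [h1, h2, h3, h4, abs_of_nonneg (Real.rpow_nonneg (abs_nonneg _) _),
      abs_of_nonneg (Real.rpow_nonneg (abs_nonneg _) _)]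
    refine Real.rpow_le_rpow (abs_nonneg _) ?_ (by positivity)
    change |max (X.concavToL0 h f ω) 0| ≤ _
    rw [abs_of_nonneg (le_max_right _ _)]
    exact max_le (le_abs_self _) (abs_nonneg _)⟩ : X.concavSubmodule h)

theorem coeFn_concavPosPart {X : BanachFunctionLattice μ} {p : ℝ} (h : X.IsPConvex p)
    (f : X.Concav h) :
    ∀ᵐ ω ∂μ, X.concavToL0 h (concavPosPart h f) ω = max (X.concavToL0 h f ω) 0 := by
  change ∀ᵐ ω ∂μ, (X.concavToL0 h f ⊔ 0 : Ω →ₘ[μ] ℝ) ω = _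
  filter_upwards [AEEqFun.coeFn_sup (X.concavToL0 h f) 0,
    AEEqFun.coeFn_zero (α := Ω) (μ := μ) (β := ℝ)] with ω h3 h4
  rw [h3, h4]
  rfl

theorem norm_concavPosPart_le {X : BanachFunctionLattice μ} {p : ℝ} (h : X.IsPConvex p)
    (f : X.Concav h) : ‖concavPosPart h f‖ ≤ ‖f‖ := by
  refine concav_norm_le_of_abs_le h ?_
  filter_upwards [coeFn_concavPosPart h f] with ω h1
  rw [h1, abs_of_nonneg (le_max_right _ _)]
  exact max_le (le_abs_self _) (abs_nonneg _)

theorem concavPosPart_smul {X : BanachFunctionLattice μ} {p : ℝ} (h : X.IsPConvex p) {c : ℝ}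
    (hc : 0 ≤ c) (f : X.Concav h) : concavPosPart h (c • f) = c • concavPosPart h f := by
  refine Subtype.ext (AEEqFun.ext ?_)
  change X.concavToL0 h (concavPosPart h (c • f)) =ᵐ[μ] X.concavToL0 h (c • concavPosPart h f)
  rw [map_smul]
  filter_upwards [coeFn_concavPosPart h (c • f), coeFn_concavPosPart h f,
    AEEqFun.coeFn_smul c (X.concavToL0 h (concavPosPart h f)),
    AEEqFun.coeFn_smul c (X.concavToL0 h f)] with ω h1 h2 h3 h4
  rw [h1, h3, map_smul, h4, Pi.smul_apply, Pi.smul_apply, h2, smul_eq_mul, smul_eq_mul,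
    mul_max_of_nonneg _ _ hc, mul_zero]

/-- Pointwise `(f + g)⁺ ≤ f⁺ + g⁺`. Together with positive homogeneity this makes `g ↦ ‖g⁺‖`
sublinear, hence a majorant for Hahn-Banach that forces positivity. -/
theorem norm_concavPosPart_add_le {X : BanachFunctionLattice μ} {p : ℝ} (h : X.IsPConvex p)
    (f g : X.Concav h) :
    ‖concavPosPart h (f + g)‖ ≤ ‖concavPosPart h f‖ + ‖concavPosPart h g‖ := by
  refine (concav_norm_le_of_abs_le h ?_).trans (norm_add_le _ _)
  rw [map_add]
  filter_upwards [coeFn_concavPosPart h (f + g), coeFn_concavPosPart h f, coeFn_concavPosPart h g,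
    AEEqFun.coeFn_add (X.concavToL0 h f) (X.concavToL0 h g),
    AEEqFun.coeFn_add (X.concavToL0 h (concavPosPart h f)) (X.concavToL0 h (concavPosPart h g))]
    with ω h1 h2 h3 h4 h5
  rw [h1, h5, map_add, h4, Pi.add_apply, Pi.add_apply, h2, h3, abs_of_nonneg (le_max_right _ _),
    abs_of_nonneg (add_nonneg (le_max_right _ _) (le_max_right _ _))]
  exact max_le (add_le_add (le_max_left _ _) (le_max_left _ _))
    (add_nonneg (le_max_right _ _) (le_max_right _ _))

/-- Every `f ≥ 0` in `X_p` is normed by a positive functional of the dual unit ball. -/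
theorem exists_mem_posBall_eval_eq_norm {X : BanachFunctionLattice μ} {p : ℝ}
    (h : X.IsPConvex p) (f : X.Concav h) (hf : 0 ≤ X.concavToL0 h f) :
    ∃ φ ∈ X.posBall h, φ.1 f = ‖f‖ := by
  have hmono : ∀ g : X.Concav h, 0 ≤ X.concavToL0 h g → concavPosPart h g = g := fun g hg => by
    refine Subtype.ext (AEEqFun.ext ?_)
    change X.concavToL0 h (concavPosPart h g) =ᵐ[μ] X.concavToL0 h g
    filter_upwards [coeFn_concavPosPart h g, AEEqFun.coeFn_le.2 hg,
      AEEqFun.coeFn_zero (α := Ω) (μ := μ) (β := ℝ)] with ω h1 h2 h3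
    rw [h3] at h2
    exact h1.trans (max_eq_left h2)
  have hneg : ∀ g : X.Concav h, 0 ≤ X.concavToL0 h g → ‖concavPosPart h (-g)‖ = 0 := fun g hg => by
    refine le_antisymm ?_ (norm_nonneg _)
    rw [← norm_zero (E := X.Concav h)]
    refine concav_norm_le_of_abs_le h ?_
    filter_upwards [coeFn_concavPosPart h (-g), AEEqFun.coeFn_le.2 hg,
      AEEqFun.coeFn_neg (X.concavToL0 h g),
      AEEqFun.coeFn_zero (α := Ω) (μ := μ) (β := ℝ)] with ω h1 h2 h3 h4
    rw [h4] at h2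
    have h5 : X.concavToL0 h (-g) ω = -X.concavToL0 h g ω := by rw [map_neg, h3]; rfl
    rw [h1, h5, max_eq_right (neg_nonpos.2 h2), abs_zero]
    exact abs_nonneg _
  -- Extend `c f ↦ c ‖f‖` from the line through `f`. On that line it is below `‖g⁺‖`: for `c ≥ 0`
  -- there is equality because `f ≥ 0`, and for `c ≤ 0` the value is nonpositive.
  have hdom : ∃ F : X.Concav h →ₗ[ℝ] ℝ, F f = ‖f‖ ∧ ∀ g, F g ≤ ‖concavPosPart h g‖ := by
    by_cases h0 : f = 0
    · exact ⟨0, by simp [h0], fun g => norm_nonneg _⟩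
    obtain ⟨F, hF1, hF2⟩ := exists_extension_of_le_sublinear
      (LinearPMap.mkSpanSingleton f ‖f‖ h0) (fun g => ‖concavPosPart h g‖)
      (fun c hc g => by
        rw [concavPosPart_smul h hc.le, norm_smul, Real.norm_of_nonneg hc.le])
      (norm_concavPosPart_add_le h) (by
        rintro ⟨g, hg⟩
        obtain ⟨c, rfl⟩ := Submodule.mem_span_singleton.1 hg
        rw [LinearPMap.mkSpanSingleton'_apply, smul_eq_mul]
        rcases le_total 0 c with hc | hc
        · rw [concavPosPart_smul h hc, hmono f hf, norm_smul, Real.norm_of_nonneg hc, RingHom.id_apply]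
        · exact (mul_nonpos_of_nonpos_of_nonneg hc (norm_nonneg _)).trans (norm_nonneg _))
    refine ⟨F, ?_, hF2⟩
    have h1 := hF1 ⟨f, Submodule.mem_span_singleton_self f⟩
    rw [LinearPMap.mkSpanSingleton_apply] at h1
    exact h1
  obtain ⟨F, hFf, hF⟩ := hdom
  have hle : ∀ g, ‖F g‖ ≤ 1 * ‖g‖ := fun g => by
    rw [one_mul, Real.norm_eq_abs, abs_le]
    constructor
    · have h1 := (hF (-g)).trans (norm_concavPosPart_le h (-g))
      rw [map_neg, norm_neg] at h1
      linarith
    · exact (hF g).trans (norm_concavPosPart_le h g)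
  refine ⟨(⟨StrongDual.toWeakDual (F.mkContinuous 1 hle),
    F.mkContinuous_norm_le zero_le_one hle⟩ :
    {φ : WeakDual ℝ (X.Concav h) // ‖WeakDual.toStrongDual φ‖ ≤ 1}), fun g hg => ?_, hFf⟩
  change 0 ≤ F g
  -- For `g ≥ 0` the majorant vanishes at `-g`, so `-F g ≤ 0`.
  have h1 := hF (-g)
  rw [hneg g hg, map_neg] at h1
  linarith

/-- Banach-Alaoglu. Compactness serves both the attained maximum in `exists_strongSup_le` and the
Riesz theorem. -/
instance (X : BanachFunctionLattice μ) {p : ℝ} (h : X.IsPConvex p) :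
    CompactSpace (X.DualBall h) := by
  have h1 := WeakDual.isCompact_closedBall (𝕜 := ℝ) (0 : StrongDual ℝ (X.Concav h)) 1
  have h2 : WeakDual.toStrongDual ⁻¹' Metric.closedBall (0 : StrongDual ℝ (X.Concav h)) 1 =
      {φ : WeakDual ℝ (X.Concav h) | ‖WeakDual.toStrongDual φ‖ ≤ 1} := by
    ext φ
    simp
  rw [h2] at h1
  exact isCompact_iff_compactSpace.1 h1

instance (X : BanachFunctionLattice μ) {p : ℝ} (h : X.IsPConvex p) : T2Space (X.DualBall h) :=
  inferInstanceAs (T2Space {φ : WeakDual ℝ (X.Concav h) // ‖WeakDual.toStrongDual φ‖ ≤ 1})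

theorem posBall_nonempty (X : BanachFunctionLattice μ) {p : ℝ} (h : X.IsPConvex p) :
    (X.posBall h).Nonempty := by
  obtain ⟨φ, hφ, -⟩ := exists_mem_posBall_eval_eq_norm h 0 (by rw [map_zero])
  exact ⟨φ, hφ⟩

instance (X : BanachFunctionLattice μ) {p : ℝ} (h : X.IsPConvex p) :
    CompactSpace (X.posBall h) :=
  isCompact_iff_compactSpace.1 (X.isClosed_posBall h).isCompact

/-- Passing to `X_p` makes `p`-sums linear in `|x_k|^p`, so that functionals can be applied term by
term. -/
theorem norm_lpSum_smul_rpow {X : BanachFunctionLattice μ} {p : ℝ} (h : X.IsPConvex p) {n : ℕ}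
    (β : Fin n → ℝ) (x : Fin n → X.Elem) :
    ‖X.lpSum h.one_le fun k => β k • x k‖ ^ p = ‖∑ k, |β k| ^ p • pow h (x k)‖ := by
  rw [concav_norm_def]
  congr 2
  refine Subtype.ext ?_
  change absPow (1 / p) (∑ k, absPow p (X.toL0 (β k • x k))) =
    absPow (1 / p) (X.concavToL0 h (∑ k, |β k| ^ p • pow h (x k)))
  rw [map_sum]
  congr 1
  refine Finset.sum_congr rfl fun k _ => ?_
  rw [← pow_smul]
  rfl

theorem strongSup_nonneg (X : BanachFunctionLattice μ) {p : ℝ} (hp : 1 ≤ p) (q : ℝ) {n : ℕ}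
    (x : Fin n → X.Elem) : 0 ≤ X.strongSup hp q x :=
  Real.iSup_nonneg fun _ => norm_nonneg _

/-- The values of the functionals of the positive dual ball are controlled by `strongSup`. -/
theorem sum_eval_pow_rpow_le_strongSup {X : BanachFunctionLattice μ} {p q : ℝ}
    (h : X.IsPConvex p) (hpq : p ≤ q) {n : ℕ} (x : Fin n → X.Elem) {φ : X.DualBall h}
    (hφ : φ ∈ X.posBall h) :
    ∑ k, φ.1 (pow h (x k)) ^ (q / p) ≤ X.strongSup h.one_le q x ^ q := by
  have hp0 : 0 < p := by linarith [h.one_le]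
  have hq0 : 0 < q := by linarith
  have ha := fun k => eval_pow_nonneg h hφ (x k)
  -- This `β` turns the `ℓ_{q/p}` norm of the values of `φ` into the value of `φ` at a single
  -- element of `X_p`.
  obtain ⟨β, hβ, e⟩ := exists_sum_abs_rpow_mul_eq h.one_le hpq ha
  have hs : 0 ≤ ∑ k, φ.1 (pow h (x k)) ^ (q / p) :=
    Finset.sum_nonneg fun k _ => Real.rpow_nonneg (ha k) _
  have h1 : (∑ k, φ.1 (pow h (x k)) ^ (q / p)) ^ (p / q) ≤ X.strongSup h.one_le q x ^ p := by
    calc _ = φ.1 (∑ k, |β k| ^ p • pow h (x k)) := by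
          rw [← e, map_sum]
          simp only [map_smul, smul_eq_mul]
      _ ≤ ‖∑ k, |β k| ^ p • pow h (x k)‖ := by
          have h2 := (WeakDual.toStrongDual φ.1).le_of_opNorm_le φ.2
            (∑ k, |β k| ^ p • pow h (x k))
          rw [one_mul] at h2
          exact (le_abs_self _).trans h2
      _ = ‖X.lpSum h.one_le fun k => β k • x k‖ ^ p := (norm_lpSum_smul_rpow h _ x).symm
      _ ≤ _ := Real.rpow_le_rpow (norm_nonneg _)
          (le_ciSup (X.bddAbove_strongSup h.one_le hpq x) ⟨β, hβ⟩) hp0.le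
  have h3 := Real.rpow_le_rpow (by positivity) h1 (by positivity : 0 ≤ q / p)
  rw [← Real.rpow_mul hs, ← Real.rpow_mul (X.strongSup_nonneg _ _ _)] at h3
  have e1 : p / q * (q / p) = 1 := by field_simp
  have e2 : p * (q / p) = q := by field_simp
  rwa [e1, e2, Real.rpow_one] at h3

/-- `strongSup` is controlled by the values of one functional of the positive dual ball. -/
theorem exists_strongSup_le {X : BanachFunctionLattice μ} {p q : ℝ}
    (h : X.IsPConvex p) (hpq : p ≤ q) {n : ℕ} (x : Fin n → X.Elem) :
    ∃ φ ∈ X.posBall h,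
      X.strongSup h.one_le q x ≤ (∑ k, φ.1 (pow h (x k)) ^ (q / p)) ^ (1 / q) := by
  have hp0 : 0 < p := by linarith [h.one_le]
  have hq0 : 0 < q := by linarith
  have hcont : Continuous fun φ : X.DualBall h => ∑ k, φ.1 (pow h (x k)) ^ (q / p) :=
    continuous_finsetSum _ fun k _ =>
      (X.continuous_eval h _).rpow_const fun _ => Or.inr (by positivity)
  obtain ⟨φ, hφ, hmax⟩ := (X.isClosed_posBall h).isCompact.exists_isMaxOn
    (X.posBall_nonempty h) hcont.continuousOn
  refine ⟨φ, hφ, ?_⟩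
  have hs : ∀ ψ ∈ X.posBall h, 0 ≤ ∑ k, ψ.1 (pow h (x k)) ^ (q / p) := fun ψ hψ =>
    Finset.sum_nonneg fun k _ => Real.rpow_nonneg (eval_pow_nonneg h hψ _) _
  refine Real.iSup_le (fun β => ?_) (Real.rpow_nonneg (hs φ hφ) _)
  have hpos : 0 ≤ X.concavToL0 h (∑ k, |β.1 k| ^ p • pow h (x k)) := by
    rw [map_sum]
    refine Finset.sum_induction _ (fun f : Ω →ₘ[μ] ℝ => 0 ≤ f) (fun f g hf hg => ?_) le_rfl
      fun k _ => ?_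
    · rw [← AEEqFun.coeFn_le] at hf hg ⊢
      filter_upwards [hf, hg, AEEqFun.coeFn_add f g,
        AEEqFun.coeFn_zero (α := Ω) (μ := μ) (β := ℝ)] with ω h1 h2 h3 h4
      rw [h4] at h1 h2 ⊢
      rw [h3]
      exact add_nonneg h1 h2
    · rw [← pow_smul]
      exact pow_nonneg' h _
  -- The norming functional `ψ` depends on `β`. After Hölder removes `β`, the maximiser `φ`
  -- dominates every such `ψ`, which gives one functional for the whole supremum.
  obtain ⟨ψ, hψ, e⟩ := exists_mem_posBall_eval_eq_norm h _ hpos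
  have h1 : ‖X.lpSum h.one_le fun k => β.1 k • x k‖ ^ p ≤
      (∑ k, φ.1 (pow h (x k)) ^ (q / p)) ^ (p / q) := by
    calc _ = ∑ k, |β.1 k| ^ p * ψ.1 (pow h (x k)) := by
          rw [norm_lpSum_smul_rpow h (fun k => β.1 k) x, ← e, map_sum]
          simp only [map_smul, smul_eq_mul]
      _ ≤ (∑ k, ψ.1 (pow h (x k)) ^ (q / p)) ^ (p / q) :=
          sum_abs_rpow_mul_le h.one_le hpq β.2 fun k => eval_pow_nonneg h hψ _
      _ ≤ _ := Real.rpow_le_rpow (hs ψ hψ) (hmax hψ) (by positivity)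
  have e1 : p / q = 1 / q * p := by ring
  rw [e1, Real.rpow_mul (hs φ hφ)] at h1
  exact (Real.rpow_le_rpow_iff (norm_nonneg _) (Real.rpow_nonneg (hs φ hφ) _) hp0).1 h1

end BanachFunctionLattice

/-! ### Separation from the cone of strictly positive functions. -/

/-- If a convex set of continuous functions on a compact space contains no strictly positive
function, then some state is nonpositive on it. -/
theorem ContinuousMap.exists_state_nonpos {K : Type*} [TopologicalSpace K] [CompactSpace K]
    {A : Set C(K, ℝ)} (hA : Convex ℝ A) (h0 : 0 ∈ A) (hpos : ∀ f ∈ A, ∃ x, f x ≤ 0) :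
    ∃ Λ : C(K, ℝ) →ₗ[ℝ] ℝ, (∀ f, 0 ≤ f → 0 ≤ Λ f) ∧ Λ 1 = 1 ∧ ∀ f ∈ A, Λ f ≤ 0 := by
  have hK : Nonempty K := ⟨(hpos 0 h0).choose⟩
  let U : Set C(K, ℝ) := {f | ∀ x, 0 < f x}
  have hUo : IsOpen U := by
    have := ContinuousMap.isOpen_setOfPred_mapsTo (X := K) (Y := ℝ) isCompact_univ
      (isOpen_Ioi (a := (0 : ℝ)))
    convert this using 1
    ext f
    simp [U, Set.MapsTo]
  have hUc : Convex ℝ U := by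
    intro f hf g hg a b ha hb hab x
    change 0 < a * f x + b * g x
    rcases ha.eq_or_lt with rfl | ha
    · rw [zero_add] at hab
      simpa [hab] using hg x
    · exact add_pos_of_pos_of_nonneg (mul_pos ha (hf x)) (mul_nonneg hb (hg x).le)
  obtain ⟨L, u, hLU, hLA⟩ := geometric_hahn_banach_open hUc hUo hA
    (Set.disjoint_left.2 fun f hfU hfA => by
      obtain ⟨x, hx⟩ := hpos f hfA
      exact hx.not_gt (hfU x))
  have hu : u ≤ 0 := by simpa using hLA 0 h0
  have h1U : (1 : C(K, ℝ)) ∈ U := fun x => zero_lt_one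
  have hL1 : L 1 < 0 := (hLU 1 h1U).trans_le hu
  -- If `L f > 0` for some `f ≥ 0`, a suitable multiple of `f` added to `1` stays in `U` but has
  -- `L`-value zero, whereas `L < 0` on `U`.
  have hLpos : ∀ f : C(K, ℝ), 0 ≤ f → L f ≤ 0 := fun f hf => by
    by_contra! hlt
    have hmem : (1 + (-L 1 / L f) • f : C(K, ℝ)) ∈ U := fun x => by
      change 0 < 1 + (-L 1 / L f) * f x
      have h2 : 0 ≤ f x := hf x
      have h3 : 0 ≤ -L 1 / L f := div_nonneg (by linarith) hlt.le
      positivity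
    have h4 := (hLU _ hmem).trans_le hu
    rw [map_add, map_smul, smul_eq_mul, div_mul_cancel₀ _ hlt.ne'] at h4
    linarith
  -- Separation only gives `u ≤ L f`. Small positive constants lie in `U` and have `L`-values close
  -- to zero, so a negative `L f` is impossible; the chosen constant has value `L f / 2`.
  have hLA' : ∀ f ∈ A, 0 ≤ L f := fun f hf => by
    by_contra! hlt
    obtain ⟨c, hc0, hc⟩ : ∃ c : ℝ, 0 < c ∧ c * L 1 > L f :=
      ⟨L f / (2 * L 1), div_pos_of_neg_of_neg hlt (by linarith), by
        have : L f / (2 * L 1) * L 1 = L f / 2 := by field_simp [hL1.ne]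
        rw [this]; linarith⟩
    have hmem : (c • 1 : C(K, ℝ)) ∈ U := fun x => by
      change 0 < c * 1
      linarith
    have h5 := hLU _ hmem
    rw [map_smul, smul_eq_mul] at h5
    linarith [hLA f hf]
  -- Dividing by the negative number `L 1` normalises and reverses both signs.
  refine ⟨(L 1)⁻¹ • L.toLinearMap, fun f hf => ?_, ?_, fun f hf => ?_⟩
  · exact mul_nonneg_of_nonpos_of_nonpos (inv_nonpos.2 hL1.le) (hLpos f hf)
  · exact inv_mul_cancel₀ hL1.ne
  · exact mul_nonpos_of_nonpos_of_nonneg (inv_nonpos.2 hL1.le) (hLA' f hf)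

/-! ### The seminorms `rho` as integrals over the positive ball. -/

namespace BanachFunctionLattice

section
variable {Ω : Type*} [MeasurableSpace Ω] {μ : Measure Ω}

theorem denseRange_iota (X : BanachFunctionLattice μ) {p q : ℝ} (h : X.IsPConvex p) (hpq : p ≤ q)
    (ν : ProbabilityMeasure (X.DualBall h)) : DenseRange (X.iota h hpq ν) :=
  UniformSpace.Completion.denseRange_coe.comp SeparationQuotient.surjective_mk.denseRange
    (UniformSpace.Completion.continuous_coe _)

theorem rho_nonneg {X : BanachFunctionLattice μ} {p : ℝ} (h : X.IsPConvex p) (q : ℝ)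
    (ν : ProbabilityMeasure (X.DualBall h)) (x : X.Elem) : 0 ≤ rho h q ν x :=
  Real.rpow_nonneg (setIntegral_nonneg (X.isClosed_posBall h).measurableSet fun _ hφ =>
    Real.rpow_nonneg (eval_pow_nonneg h hφ x) _) _

theorem rho_rpow {X : BanachFunctionLattice μ} {p q : ℝ} (h : X.IsPConvex p) (hq : 0 < q)
    (ν : ProbabilityMeasure (X.DualBall h)) (x : X.Elem) :
    rho h q ν x ^ q =
      ∫ φ in X.posBall h, (φ.1 (pow h x)) ^ (q / p) ∂(ν : Measure (X.DualBall h)) := by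
  rw [rho, one_div, Real.rpow_inv_rpow _ hq.ne']
  exact setIntegral_nonneg (X.isClosed_posBall h).measurableSet fun _ hφ =>
    Real.rpow_nonneg (eval_pow_nonneg h hφ x) _

/-- The function `φ ↦ |⟨|x| ^ p, φ⟩| ^ t` on the dual ball. -/
def evalPow {X : BanachFunctionLattice μ} {p : ℝ} (h : X.IsPConvex p) {t : ℝ} (ht : 0 ≤ t)
    (x : X.Elem) : C(X.DualBall h, ℝ) :=
  ⟨fun φ => |φ.1 (pow h x)| ^ t,
    (X.continuous_eval h _).abs.rpow_const fun _ => Or.inr ht⟩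

theorem evalPow_apply {X : BanachFunctionLattice μ} {p : ℝ} (h : X.IsPConvex p) {t : ℝ}
    (ht : 0 ≤ t) (x : X.Elem) {φ : X.DualBall h} (hφ : φ ∈ X.posBall h) :
    evalPow h ht x φ = φ.1 (pow h x) ^ t := by
  change |φ.1 (pow h x)| ^ t = _
  rw [abs_of_nonneg (eval_pow_nonneg h hφ x)]

/-- The absolute value in `evalPow` makes this hold on the whole ball, including functionals that
are negative at `|x|^p`. -/
theorem evalPow_smul {X : BanachFunctionLattice μ} {p q : ℝ} (h : X.IsPConvex p)
    (ht : 0 ≤ q / p) (c : ℝ) (x : X.Elem) : evalPow h ht (c • x) = |c| ^ q • evalPow h ht x := by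
  have hp0 : 0 < p := by linarith [h.one_le]
  ext φ
  change |φ.1 (pow h (c • x))| ^ (q / p) = |c| ^ q * |φ.1 (pow h x)| ^ (q / p)
  rw [pow_smul, map_smul, smul_eq_mul, abs_mul, Real.mul_rpow (abs_nonneg _) (abs_nonneg _),
    abs_of_nonneg (Real.rpow_nonneg (abs_nonneg c) _), ← Real.rpow_mul (abs_nonneg _),
    mul_div_cancel₀ _ hp0.ne']

/-- Integrate `sum_eval_pow_rpow_le_strongSup` over the positive ball, whose measure is at most one.
-/
theorem sum_rho_rpow_le {X : BanachFunctionLattice μ} {p q : ℝ} (h : X.IsPConvex p) (hpq : p ≤ q)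
    (ν : ProbabilityMeasure (X.DualBall h)) {n : ℕ} (x : Fin n → X.Elem) :
    ∑ k, rho h q ν (x k) ^ q ≤ X.strongSup h.one_le q x ^ q := by
  have hp0 : 0 < p := by linarith [h.one_le]
  have hq0 : 0 < q := by linarith
  have ht : 0 ≤ q / p := by positivity
  have hint : ∀ k, Integrable (evalPow h ht (x k))
      ((ν : Measure (X.DualBall h)).restrict (X.posBall h)) := fun k =>
    BoundedContinuousFunction.integrable _ (BoundedContinuousFunction.mkOfCompact _)
  calc ∑ k, rho h q ν (x k) ^ q
      = ∑ k, ∫ φ in X.posBall h, evalPow h ht (x k) φ ∂(ν : Measure (X.DualBall h)) := by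
        refine Finset.sum_congr rfl fun k _ => ?_
        rw [rho_rpow h hq0]
        exact setIntegral_congr_fun (X.isClosed_posBall h).measurableSet fun φ hφ =>
          (evalPow_apply h ht _ hφ).symm
    _ = ∫ φ in X.posBall h, ∑ k, evalPow h ht (x k) φ ∂(ν : Measure (X.DualBall h)) :=
        (integral_finsetSum _ fun k _ => hint k).symm
    _ ≤ ∫ φ in X.posBall h, X.strongSup h.one_le q x ^ q ∂(ν : Measure (X.DualBall h)) := by
        refine setIntegral_mono_on (integrable_finsetSum _ fun k _ => hint k)
          (integrable_const _) (X.isClosed_posBall h).measurableSet fun φ hφ => ?_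
        refine le_trans (le_of_eq ?_) (sum_eval_pow_rpow_le_strongSup h hpq x hφ)
        exact Finset.sum_congr rfl fun k _ => evalPow_apply h ht _ hφ
    _ ≤ _ := by
        rw [setIntegral_const, smul_eq_mul]
        exact mul_le_of_le_one_left (Real.rpow_nonneg (X.strongSup_nonneg _ _ _) _)
          measureReal_le_one

/-- A state on `C(B)` that only depends on the values on the positive part of the dual ball `B`
is represented by a regular measure that is concentrated on the positive part. -/
theorem exists_measure_of_state {X : BanachFunctionLattice μ} {p : ℝ} (h : X.IsPConvex p)
    (Λ : C(X.DualBall h, ℝ) →ₗ[ℝ] ℝ) (hΛ : ∀ f, 0 ≤ f → 0 ≤ Λ f) (h1 : Λ 1 = 1)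
    (hsupp : ∀ f, (∀ φ ∈ X.posBall h, f φ = 0) → Λ f = 0) :
    ∃ ν : ProbabilityMeasure (X.DualBall h), (ν : Measure (X.DualBall h)).Regular ∧
      ∀ f : C(X.DualBall h, ℝ), ∫ φ in X.posBall h, f φ ∂(ν : Measure (X.DualBall h)) = Λ f := by
  obtain ⟨ν, hν, hint⟩ := ContinuousMap.exists_regular_probabilityMeasure Λ hΛ h1
  refine ⟨ν, hν, fun f => ?_⟩
  have hnull : (ν : Measure (X.DualBall h)) (X.posBall h)ᶜ = 0 := by
    -- By inner regularity it is enough to treat compact sets `C` off the positive ball. A Urysohn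
    -- function equal to one on `C` and zero on the ball has integral zero.
    rw [(X.isClosed_posBall h).isOpen_compl.measure_eq_iSup_isCompact]
    simp only [ENNReal.iSup_eq_zero]
    intro C hC hCc
    obtain ⟨g, hg0, hg1, hg⟩ := exists_continuous_zero_one_of_isClosed (X.isClosed_posBall h)
      hCc.isClosed (Set.disjoint_right.2 fun φ hφ => hC hφ)
    have h2 : ∫ φ, g φ ∂(ν : Measure (X.DualBall h)) = 0 := by
      rw [hint, hsupp g hg0]
    have hgi : Integrable g (ν : Measure (X.DualBall h)) :=
      BoundedContinuousFunction.integrable _ (BoundedContinuousFunction.mkOfCompact g)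
    have h3 := (integral_eq_zero_iff_of_nonneg (fun φ => (hg φ).1) hgi).1 h2
    refine measure_mono_null (fun φ hφ => ?_) h3
    change ¬ g φ = 0
    rw [hg1 hφ]
    exact one_ne_zero
  rw [Measure.restrict_eq_self_of_ae_mem (s := X.posBall h) (mem_ae_iff.2 hnull), hint]

end

/-! ### Domination by the product of the seminorms. -/

section
variable {m : ℕ} {Ω : Fin m → Type*} [∀ j, MeasurableSpace (Ω j)] {μ : ∀ j, Measure (Ω j)}
  {X : ∀ j, BanachFunctionLattice (μ j)} {Y : Type*} [NormedAddCommGroup Y] [NormedSpace ℝ Y]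
  {p q : Fin m → ℝ} {s : ℝ}

/-- With no variables the sum would be empty and `s` would be zero, hence `1 ≤ m`. -/
theorem exponent_pos (hm : 1 ≤ m) (hq : ∀ j, 1 ≤ q j) (hs : 1 / s = ∑ j, 1 / q j) : 0 < s := by
  have : NeZero m := ⟨by omega⟩
  rw [← one_div_pos, hs]
  exact Finset.sum_pos (fun j _ => one_div_pos.2 (by linarith [hq j])) Finset.univ_nonempty

theorem sum_exponent_div (hs0 : 0 < s) (hs : 1 / s = ∑ j, 1 / q j) : ∑ j, s / q j = 1 := by
  have : ∀ j, s / q j = s * (1 / q j) := fun j => by ring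
  simp only [this]
  rw [← Finset.mul_sum, ← hs, mul_one_div_cancel hs0.ne']

/-- Hölder over `k` with weights `s/q_j` separates the variables; `sum_rho_rpow_le` then bounds each
factor. -/
theorem isStronglyConcave_of_norm_le (hm : 1 ≤ m) (hX : ∀ j, (X j).IsPConvex (p j))
    (hpq : ∀ j, p j ≤ q j) (hs : 1 / s = ∑ j, 1 / q j)
    (T : MultilinearMap ℝ (fun j => (X j).Elem) Y)
    (ν : ∀ j, ProbabilityMeasure ((X j).DualBall (hX j))) {C : ℝ} (hC : 0 < C)
    (hT : ∀ x, ‖T x‖ ≤ C * ∏ j, rho (hX j) (q j) (ν j) (x j)) :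
    IsStronglyConcave X (fun j => (hX j).one_le) q s T := by
  have hq : ∀ j, 1 ≤ q j := fun j => (hX j).one_le.trans (hpq j)
  have hs0 := exponent_pos hm hq hs
  have hq0 : ∀ j, 0 < q j := fun j => by linarith [hq j]
  refine ⟨C, hC, fun n x => ?_⟩
  have hρ := fun j k => rho_nonneg (hX j) (q j) (ν j) (x j k)
  have hsup := fun j => (X j).strongSup_nonneg (hX j).one_le (q j) (x j)
  rw [one_div, Real.rpow_inv_le_iff_of_pos (Finset.sum_nonneg fun k _ =>
    Real.rpow_nonneg (norm_nonneg _) _) (mul_nonneg hC.le (Finset.prod_nonneg fun j _ => hsup j))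
    hs0]
  calc ∑ k, ‖T fun j => x j k‖ ^ s
      ≤ ∑ k, C ^ s * ∏ j, (rho (hX j) (q j) (ν j) (x j k) ^ q j) ^ (s / q j) := by
        refine Finset.sum_le_sum fun k _ => ?_
        refine (Real.rpow_le_rpow (norm_nonneg _) (hT _) hs0.le).trans (le_of_eq ?_)
        rw [Real.mul_rpow hC.le (Finset.prod_nonneg fun j _ => hρ j k),
          ← Real.finsetProd_rpow _ _ fun j _ => hρ j k]
        congr 1
        refine Finset.prod_congr rfl fun j _ => ?_
        rw [← Real.rpow_mul (hρ j k), mul_div_cancel₀ _ (hq0 j).ne']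
    _ ≤ C ^ s * ∏ j, (∑ k, rho (hX j) (q j) (ν j) (x j k) ^ q j) ^ (s / q j) := by
        rw [← Finset.mul_sum]
        exact mul_le_mul_of_nonneg_left (Real.sum_prod_rpow_le
          (fun j => div_pos hs0 (hq0 j)) (sum_exponent_div hs0 hs)
          fun j k => Real.rpow_nonneg (hρ j k) _) (by positivity)
    _ ≤ C ^ s * ∏ j, ((X j).strongSup (hX j).one_le (q j) (x j) ^ q j) ^ (s / q j) := by
        refine mul_le_mul_of_nonneg_left (Finset.prod_le_prod (fun j _ => ?_) fun j _ => ?_)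
          (by positivity)
        · exact Real.rpow_nonneg (Finset.sum_nonneg fun k _ => Real.rpow_nonneg (hρ j k) _) _
        · exact Real.rpow_le_rpow (Finset.sum_nonneg fun k _ => Real.rpow_nonneg (hρ j k) _)
            (sum_rho_rpow_le (hX j) (hpq j) (ν j) (x j)) (div_pos hs0 (hq0 j)).le
    _ = (C * ∏ j, (X j).strongSup (hX j).one_le (q j) (x j)) ^ s := by
        rw [Real.mul_rpow hC.le (Finset.prod_nonneg fun j _ => hsup j),
          ← Real.finsetProd_rpow _ _ fun j _ => hsup j]
        congr 1
        refine Finset.prod_congr rfl fun j _ => ?_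
        rw [← Real.rpow_mul (hsup j), mul_div_cancel₀ _ (hq0 j).ne']

/-- The function on the product of the positive dual balls that measures the failure of the
domination of `T` at the point `x`. -/
def defect (hX : ∀ j, (X j).IsPConvex (p j)) (ht : ∀ j, 0 ≤ q j / p j) (s C : ℝ)
    (T : MultilinearMap ℝ (fun j => (X j).Elem) Y) (x : ∀ j, (X j).Elem) :
    C(∀ j, (X j).posBall (hX j), ℝ) :=
  ‖T x‖ ^ s • (1 : C(∀ j, (X j).posBall (hX j), ℝ)) - ∑ j, (C ^ s * (s / q j)) •
    (evalPow (hX j) (ht j) (x j)).comp ⟨fun φ => (φ j).1, by fun_prop⟩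

theorem defect_apply (hX : ∀ j, (X j).IsPConvex (p j)) (ht : ∀ j, 0 ≤ q j / p j) (s C : ℝ)
    (T : MultilinearMap ℝ (fun j => (X j).Elem) Y) (x : ∀ j, (X j).Elem)
    (φ : ∀ j, (X j).posBall (hX j)) :
    defect hX ht s C T x φ = ‖T x‖ ^ s -
      ∑ j, C ^ s * (s / q j) * (φ j).1.1 (pow (hX j) (x j)) ^ (q j / p j) := by
  simp only [defect, ContinuousMap.sub_apply, ContinuousMap.smul_apply, ContinuousMap.one_apply,
    ContinuousMap.sum_apply, ContinuousMap.comp_apply, ContinuousMap.coe_mk, smul_eq_mul, mul_one]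
  congr 1
  exact Finset.sum_congr rfl fun j _ => by rw [evalPow_apply _ _ _ (φ j).2]

/-- By multilinearity the factors `c^(1/q_j)` contribute `c^(∑ s/q_j) = c` to `‖T x‖^s`, and each
integrand has degree `q_j`. Hence nonnegative multiples of defects are defects. -/
theorem defect_smul (hX : ∀ j, (X j).IsPConvex (p j)) (ht : ∀ j, 0 ≤ q j / p j)
    (hq : ∀ j, 0 < q j) (hs0 : 0 < s) (hs : ∑ j, s / q j = 1) (C : ℝ)
    (T : MultilinearMap ℝ (fun j => (X j).Elem) Y) (x : ∀ j, (X j).Elem) {c : ℝ} (hc : 0 ≤ c) :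
    defect hX ht s C T (fun j => c ^ (1 / q j) • x j) = c • defect hX ht s C T x := by
  have hcj : ∀ j, 0 ≤ c ^ (1 / q j) := fun j => Real.rpow_nonneg hc _
  have h1 : ‖T fun j => c ^ (1 / q j) • x j‖ ^ s = c * ‖T x‖ ^ s := by
    rw [T.map_smul_univ, norm_smul, Real.norm_of_nonneg (Finset.prod_nonneg fun j _ => hcj j),
      Real.mul_rpow (Finset.prod_nonneg fun j _ => hcj j) (norm_nonneg _),
      ← Real.finsetProd_rpow _ _ fun j _ => hcj j]
    congr 1
    have h2 : ∀ j, (c ^ (1 / q j)) ^ s = c ^ (s / q j) := fun j => by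
      rw [← Real.rpow_mul hc]
      congr 1
      ring
    simp only [h2]
    rw [← Real.rpow_sum_of_nonneg hc fun j _ => (div_pos hs0 (hq j)).le, hs, Real.rpow_one]
  rw [defect, defect, h1, smul_sub, Finset.smul_sum, mul_smul]
  congr 1
  refine Finset.sum_congr rfl fun j _ => ?_
  rw [evalPow_smul, abs_of_nonneg (hcj j), one_div, Real.rpow_inv_rpow hc (hq j).ne']
  ext φ
  simp only [ContinuousMap.smul_apply, ContinuousMap.comp_apply, smul_eq_mul]
  ring

/-- On a product of balls the coordinates can be chosen independently, each as the functional from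
`exists_strongSup_le`. AM-GM with weights `s/q_j` replaces the product in the concavity inequality
by the sum in `defect`. -/
theorem exists_sum_defect_nonpos (hX : ∀ j, (X j).IsPConvex (p j)) (hpq : ∀ j, p j ≤ q j)
    (ht : ∀ j, 0 ≤ q j / p j) (hs0 : 0 < s) (hs : ∑ j, s / q j = 1) {C : ℝ} (hC : 0 < C)
    (T : MultilinearMap ℝ (fun j => (X j).Elem) Y)
    {n : ℕ} (x : ∀ j, Fin n → (X j).Elem)
    (hT : (∑ k, ‖T (fun j => x j k)‖ ^ s) ^ (1 / s) ≤
      C * ∏ j, (X j).strongSup (hX j).one_le (q j) (x j)) :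
    ∃ φ, ∑ k, defect hX ht s C T (fun j => x j k) φ ≤ 0 := by
  have hq0 : ∀ j, 0 < q j := fun j => by linarith [(hX j).one_le, hpq j]
  choose φ hφ hle using fun j => exists_strongSup_le (hX j) (hpq j) (x j)
  refine ⟨fun j => ⟨φ j, hφ j⟩, ?_⟩
  have hsup := fun j => (X j).strongSup_nonneg (hX j).one_le (q j) (x j)
  set a : Fin m → ℝ := fun j => ∑ k, (φ j).1 (pow (hX j) (x j k)) ^ (q j / p j) with ha
  have ha0 : ∀ j, 0 ≤ a j := fun j => Finset.sum_nonneg fun k _ =>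
    Real.rpow_nonneg (eval_pow_nonneg (hX j) (hφ j) _) _
  have h1 : ∑ k, ‖T (fun j => x j k)‖ ^ s ≤ C ^ s * ∑ j, s / q j * a j := by
    rw [one_div, Real.rpow_inv_le_iff_of_pos (Finset.sum_nonneg fun k _ =>
      Real.rpow_nonneg (norm_nonneg _) _) (mul_nonneg hC.le (Finset.prod_nonneg fun j _ => hsup j))
      hs0, Real.mul_rpow hC.le (Finset.prod_nonneg fun j _ => hsup j),
      ← Real.finsetProd_rpow _ _ fun j _ => hsup j] at hT
    refine hT.trans (mul_le_mul_of_nonneg_left ?_ (by positivity))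
    calc ∏ j, (X j).strongSup (hX j).one_le (q j) (x j) ^ s ≤ ∏ j, a j ^ (s / q j) := by
          refine Finset.prod_le_prod (fun j _ => Real.rpow_nonneg (hsup j) _) fun j _ => ?_
          refine (Real.rpow_le_rpow (hsup j) (hle j) hs0.le).trans (le_of_eq ?_)
          rw [← Real.rpow_mul (ha0 j)]
          congr 1
          ring
      _ ≤ ∑ j, s / q j * a j := Real.geom_mean_le_arith_mean_weighted _ _ _
          (fun j _ => (div_pos hs0 (hq0 j)).le) hs fun j _ => ha0 j
  simp only [defect_apply]
  rw [Finset.sum_sub_distrib, Finset.sum_comm, sub_nonpos]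
  refine h1.trans (le_of_eq ?_)
  rw [Finset.mul_sum]
  refine Finset.sum_congr rfl fun j _ => ?_
  rw [← Finset.mul_sum, ha, mul_assoc]

/-- Pietsch domination for strongly concave multilinear maps. -/
theorem exists_norm_le_prod_rho (hm : 1 ≤ m) (hX : ∀ j, (X j).IsPConvex (p j))
    (hpq : ∀ j, p j ≤ q j) (hs : 1 / s = ∑ j, 1 / q j)
    (T : MultilinearMap ℝ (fun j => (X j).Elem) Y)
    (hT : IsStronglyConcave X (fun j => (hX j).one_le) q s T) :
    ∃ C > 0, ∃ ν : ∀ j, ProbabilityMeasure ((X j).DualBall (hX j)),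
      (∀ j, (ν j : Measure ((X j).DualBall (hX j))).Regular) ∧
      ∀ x, ‖T x‖ ≤ C * ∏ j, rho (hX j) (q j) (ν j) (x j) := by
  have hp0 : ∀ j, 0 < p j := fun j => by linarith [(hX j).one_le]
  have hq : ∀ j, 1 ≤ q j := fun j => (hX j).one_le.trans (hpq j)
  have hq0 : ∀ j, 0 < q j := fun j => by linarith [hq j]
  have hs0 := exponent_pos hm hq hs
  have hs1 := sum_exponent_div hs0 hs
  have ht : ∀ j, 0 ≤ q j / p j := fun j => (div_pos (hq0 j) (hp0 j)).le
  obtain ⟨C, hC, hT⟩ := hT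
  let G := defect hX ht s C T
  have hG0 : G 0 = 0 := by
    have := defect_smul hX ht hq0 hs0 hs1 C T 0 (le_refl (0 : ℝ))
    rw [zero_smul] at this
    rw [← this]
    congr 1
    funext j
    exact (smul_zero _).symm
  obtain ⟨Λ, hΛpos, hΛ1, hΛ⟩ := ContinuousMap.exists_state_nonpos
    (convex_convexHull ℝ (Set.range G)) (subset_convexHull ℝ _ ⟨0, hG0⟩) (fun f hf => by
      obtain ⟨ι, _, w, z, hw, -, hz, rfl⟩ := mem_convexHull_iff_exists_fintype.1 hf
      choose x hx using hz
      let e := (Fintype.equivFin ι).symm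
      -- The convex weights are absorbed into the vectors by `defect_smul`, so a convex combination
      -- becomes a plain sum of defects.
      obtain ⟨φ, hφ⟩ := exists_sum_defect_nonpos hX hpq ht hs0 hs1 hC T
        (fun j k => w (e k) ^ (1 / q j) • x (e k) j) (hT _ _)
      refine ⟨φ, le_of_eq_of_le ?_ hφ⟩
      rw [ContinuousMap.sum_apply, ← e.sum_comp]
      refine Finset.sum_congr rfl fun k _ => ?_
      rw [defect_smul hX ht hq0 hs0 hs1 C T (x (e k)) (hw _), ← hx])
  -- The `j`-th marginal of `Λ`, as a state on the full dual ball. It sees only values on the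
  -- positive part because `Λ` lives on the product of positive parts.
  have hν := fun j => exists_measure_of_state (hX j)
    (Λ ∘ₗ (ContinuousMap.compRightAlgHom ℝ ℝ
      (⟨fun φ => (φ j).1, by fun_prop⟩ :
        C(∀ j, (X j).posBall (hX j), (X j).DualBall (hX j)))).toLinearMap)
    (fun f hf => hΛpos _ fun φ => hf _) hΛ1
    (fun f hf => by
      rw [← Λ.map_zero]
      refine congrArg Λ ?_
      ext φ
      exact hf _ (φ j).2)
  choose ν hreg hint using hν
  have hdom : ∀ x, ‖T x‖ ^ s ≤ C ^ s * ∑ j, s / q j * rho (hX j) (q j) (ν j) (x j) ^ q j := by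
    intro x
    have h1 := hΛ _ (subset_convexHull ℝ _ ⟨x, rfl⟩)
    change Λ (defect hX ht s C T x) ≤ 0 at h1
    rw [defect, map_sub, map_smul, hΛ1, map_sum, smul_eq_mul, mul_one, sub_nonpos] at h1
    refine h1.trans (le_of_eq ?_)
    rw [Finset.mul_sum]
    refine Finset.sum_congr rfl fun j _ => ?_
    rw [map_smul, smul_eq_mul, mul_assoc, rho_rpow (hX j) (hq0 j)]
    congr 2
    refine (hint j (evalPow (hX j) (ht j) (x j))).symm.trans ?_
    exact setIntegral_congr_fun ((X j).isClosed_posBall (hX j)).measurableSet fun φ hφ =>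
      evalPow_apply _ _ _ hφ
  refine ⟨C, hC, ν, hreg, fun x => ?_⟩
  have hρ := fun j => rho_nonneg (hX j) (q j) (ν j) (x j)
  -- Rescale every `x_j` to seminorm at most one, so that the weighted sum is at most one, and undo
  -- the scaling by multilinearity. The `ε` covers vectors of seminorm zero and tends to zero at the
  -- end.
  have hε : ∀ ε > 0, ‖T x‖ ≤ C * ∏ j, (rho (hX j) (q j) (ν j) (x j) + ε) := by
    intro ε hε
    have hb : ∀ j, 0 < rho (hX j) (q j) (ν j) (x j) + ε := fun j => by linarith [hρ j]
    have h1 := hdom fun j => (rho (hX j) (q j) (ν j) (x j) + ε)⁻¹ • x j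
    have h2 : ∑ j, s / q j * rho (hX j) (q j) (ν j)
        ((rho (hX j) (q j) (ν j) (x j) + ε)⁻¹ • x j) ^ q j ≤ 1 := by
      rw [← hs1]
      refine Finset.sum_le_sum fun j _ => mul_le_of_le_one_right (div_pos hs0 (hq0 j)).le ?_
      refine Real.rpow_le_one (rho_nonneg _ _ _ _) ?_ (hq0 j).le
      rw [rho_smul (hX j) (hq j), Real.norm_of_nonneg (inv_nonneg.2 (hb j).le),
        inv_mul_le_iff₀ (hb j)]
      linarith
    have h3 := h1.trans (mul_le_of_le_one_right (by positivity) h2)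
    rw [Real.rpow_le_rpow_iff (norm_nonneg _) hC.le hs0, T.map_smul_univ, norm_smul,
      Finset.prod_inv_distrib, norm_inv,
      Real.norm_of_nonneg (Finset.prod_nonneg fun j _ => (hb j).le),
      inv_mul_le_iff₀ (Finset.prod_pos fun j _ => hb j), mul_comm] at h3
    exact h3
  have hlim : Tendsto (fun ε : ℝ => C * ∏ j, (rho (hX j) (q j) (ν j) (x j) + ε)) (𝓝[>] 0)
      (𝓝 (C * ∏ j, rho (hX j) (q j) (ν j) (x j))) := by
    have hc : Continuous fun ε : ℝ => C * ∏ j, (rho (hX j) (q j) (ν j) (x j) + ε) := by fun_prop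
    have := (hc.tendsto 0).mono_left (nhdsWithin_le_nhds (s := Set.Ioi 0))
    simpa using this
  exact ge_of_tendsto hlim (eventually_mem_nhdsWithin.mono fun ε h => hε ε h)

end

end BanachFunctionLattice

/-! ### Factorization from domination, and back. -/

theorem theorem3p4 {m : ℕ} (hm : 1 ≤ m)
    {Ω : Fin m → Type*} [∀ j, MeasurableSpace (Ω j)]
    (μ : ∀ j, Measure (Ω j)) [∀ j, SigmaFinite (μ j)]
    (X : ∀ j, BanachFunctionLattice (μ j))
    {Y : Type*} [NormedAddCommGroup Y] [NormedSpace ℝ Y] [CompleteSpace Y]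
    (p q : Fin m → ℝ) (hX : ∀ j, (X j).IsPConvex (p j)) (hpq : ∀ j, p j ≤ q j)
    (s : ℝ) (hs : 1 / s = ∑ j, 1 / q j)
    (T : MultilinearMap ℝ (fun j => (X j).Elem) Y) :
    IsStronglyConcave X (fun j => (hX j).one_le) q s T ↔
      ∃ ν : ∀ j, ProbabilityMeasure ((X j).DualBall (hX j)),
        (∀ j, (ν j : Measure ((X j).DualBall (hX j))).Regular) ∧
        ∃ S : ContinuousMultilinearMap ℝ (fun j => (X j).FTilde (hX j) (hpq j) (ν j)) Y,
          ∀ x : ∀ j, (X j).Elem,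
            T x = S (fun j => (X j).iota (hX j) (hpq j) (ν j) (x j)) := by
  constructor
  · intro hT
    obtain ⟨C, hC, ν, hreg, hle⟩ := BanachFunctionLattice.exists_norm_le_prod_rho hm hX hpq hs T hT
    obtain ⟨S, -, hS⟩ := T.exists_continuous_factor
      (fun j => ((X j).iota (hX j) (hpq j) (ν j)).toLinearMap)
      (fun j => (X j).denseRange_iota (hX j) (hpq j) (ν j)) hC.le fun x => by
        refine (hle x).trans (le_of_eq ?_)
        congr 1
        exact Finset.prod_congr rfl fun j _ => ((X j).norm_iota (hX j) (hpq j) (ν j) (x j)).symm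
    exact ⟨ν, hreg, S, fun x => (hS x).symm⟩
  · rintro ⟨ν, -, S, hS⟩
    -- The constant must be strictly positive, and `‖S‖` may vanish.
    refine BanachFunctionLattice.isStronglyConcave_of_norm_le hm hX hpq hs T ν
      (by positivity : 0 < ‖S‖ + 1) fun x => ?_
    rw [hS]
    refine (S.le_opNorm _).trans ?_
    simp only [BanachFunctionLattice.norm_iota]
    exact mul_le_mul_of_nonneg_right (by linarith)
      (Finset.prod_nonneg fun j _ => BanachFunctionLattice.rho_nonneg _ _ _ _)

end
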